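/- For every real $\delta>0$ there is a constant $c_\delta>0$, depending only on $\delta$, such that the following holds. Let $\mathbb{F}_q$ be a finite field with $q$ elements, where $\delta<1-\frac1q$, and let $n,k\ge 1$ and $d$ be integers with $d=\delta n$. If $$\frac{q^k-1}{q-1}<\frac{c_\delta\sqrt{n}\,q^n}{\sum_{i=0}^{d-1}\binom{n}{i}(q-1)^i},$$ then there exists an $[n,k,d]$-linear code over $\mathbb{F}_q$, that is, a $k$-dimensional linear subspace $C\subseteq\mathbb{F}_q^n$ whose minimum distance $\min\{d_H(x,y): x,y\in C,\ x\neq y\}$ is equal to $d$, where $d_H(x,y)$ is the number of coordinates in which $x$ and $y$ differ. -/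

import Mathlib

open Classical in
/-- The set of all Hamming distances between two distinct codewords of a code `C ⊆ F ^ n`. -/
def codeDistances {F : Type*} {n : ℕ} (C : Set (Fin n → F)) : Set ℕ :=
  {m | ∃ x ∈ C, ∃ y ∈ C, x ≠ y ∧ hammingDist x y = m}

/-- `C` is an `[n, k, d]`-linear code over `F`: a `k`-dimensional subspace of `F ^ n` whose minimum
Hamming distance between distinct codewords exists and is exactly `d`. -/
structure IsLinearCode {F : Type*} [Field F] (n k d : ℕ) (C : Submodule F (Fin n → F)) : Prop where
  dim_eq : Module.finrank F C = k
  minDist_eq : IsLeast (codeDistances (C : Set (Fin n → F))) d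

/-! A code is the image of a random linear map `G : F^k → F^n`, and only a set `R` of
representatives of the lines of `F^k` matters. The hypothesis says that the expected number λ of `u
∈ R` whose image has weight below `d` is less than `c√n`. A union bound needs λ < 1; the factor `√n`
is gained by showing that the bad events behave almost independently.

Split the coordinates into `n - s` and `s`, with `s` of order `log n`, and expose the first block.
With positive probability three things hold at once (`exists_linearMap_of_moments`): the conditional
expectation of the number of bad words is at most `μ = √n`; no word has weight below `d - s`, so
every word can still be repaired; and no nontrivial linear relation of moderate length joins
low-weight words. By the last property any `T` low-weight vectors are linearly independent, so their
images in the second block are independent and uniform, and the bad events are `T`-wise independent.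
Truncated inclusion–exclusion (`exists_forall_not_of_independent`) then compares an error `2 μ^T /
T!` with a product at least `exp(-2sμ)`. Taking `T` about `2sμ` suffices, and some extension avoids
every bad event (`exists_extension`).

Excluding relations rests on the pair count `card_pair_le`: for nonzero `a`, `b`, the proportion of
pairs `x`, `y` in the ball with `a x + b y + z` also in the ball is exponentially small, up to
polynomial factors. This saving `ρ^(n-s)` beats the `n^(O(sT))` loss of the first moment over
relations, since `sT log n` is about `√n` times a power of `log n`.

This argument requires `q ≤ n` and `n` large. If `q ≥ n`, the hypothesis forces the Singleton bound
and Reed–Solomon codes apply; if `n` is bounded, a small `c` reduces to λ < 1. Minimum distance at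
least `d` becomes exactly `d` by zeroing coordinates. -/

/-! ### Truncated inclusion–exclusion. -/

theorem sum_powersetCard_succ_insert_prod {α : Type*} [DecidableEq α] {P : Finset α} {a : α}
    (ha : a ∉ P) (x : α → ℝ) (j : ℕ) :
    ∑ S ∈ (insert a P).powersetCard (j + 1), ∏ i ∈ S, x i =
      ∑ S ∈ P.powersetCard (j + 1), ∏ i ∈ S, x i +
        x a * ∑ S ∈ P.powersetCard j, ∏ i ∈ S, x i := by
  rw [Finset.powersetCard_succ_insert ha, Finset.sum_union, Finset.sum_image, Finset.mul_sum]
  · congr 1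
    refine Finset.sum_congr rfl fun S hS => ?_
    rw [Finset.prod_insert]
    exact fun h => ha ((Finset.mem_powersetCard.1 hS).1 h)
  · intro S hS S' hS' h
    have hS1 : a ∉ S := fun h => ha ((Finset.mem_powersetCard.1 hS).1 h)
    have hS2 : a ∉ S' := fun h => ha ((Finset.mem_powersetCard.1 hS').1 h)
    rw [← Finset.erase_insert hS1, ← Finset.erase_insert hS2, h]
  · rw [Finset.disjoint_left]
    intro S hS hS'
    obtain ⟨S', -, rfl⟩ := Finset.mem_image.1 hS'
    exact ha ((Finset.mem_powersetCard.1 hS).1 (Finset.mem_insert_self _ _))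

/-- Truncating the expansion of `∏ (1 - x i)` into elementary symmetric sums. -/
theorem abs_prod_one_sub_sub_le {α : Type*} [DecidableEq α] (P : Finset α) (x : α → ℝ)
    (h0 : ∀ i ∈ P, 0 ≤ x i) (h1 : ∀ i ∈ P, x i ≤ 1) (T : ℕ) :
    |∏ i ∈ P, (1 - x i) -
        ∑ j ∈ Finset.range T, (-1) ^ j * ∑ S ∈ P.powersetCard j, ∏ i ∈ S, x i| ≤
      ∑ S ∈ P.powersetCard T, ∏ i ∈ S, x i := by
  induction P using Finset.induction_on generalizing T with
  | empty =>
    cases T with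
    | zero => simp
    | succ T =>
      have h : ∀ j, Finset.powersetCard (j + 1) (∅ : Finset α) = ∅ := fun j => by
        simp [Finset.powersetCard_eq_empty]
      rw [Finset.sum_range_succ']
      simp [h]
  | insert a P ha ih =>
    have h0' : ∀ i ∈ P, 0 ≤ x i := fun i hi => h0 i (Finset.mem_insert_of_mem hi)
    have h1' : ∀ i ∈ P, x i ≤ 1 := fun i hi => h1 i (Finset.mem_insert_of_mem hi)
    have ha0 := h0 a (Finset.mem_insert_self _ _)
    have key := sum_powersetCard_succ_insert_prod ha x
    rw [Finset.prod_insert ha]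
    cases T with
    | zero =>
      have hp : 0 ≤ ∏ i ∈ P, (1 - x i) :=
        Finset.prod_nonneg fun i hi => sub_nonneg.2 (h1' i hi)
      have hp1 : ∏ i ∈ P, (1 - x i) ≤ 1 :=
        Finset.prod_le_one (fun i hi => sub_nonneg.2 (h1' i hi)) fun i hi => by
          linarith [h0' i hi]
      have ha1 := h1 a (Finset.mem_insert_self _ _)
      simp only [Finset.range_zero, Finset.sum_empty, sub_zero, Finset.powersetCard_zero,
        Finset.sum_singleton, Finset.prod_empty]
      rw [abs_of_nonneg (mul_nonneg (by linarith) hp)]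
      nlinarith
    | succ T =>
      have e1 := ih h0' h1' (T + 1)
      have e2 := ih h0' h1' T
      have hs : ∑ j ∈ Finset.range (T + 1), (-1 : ℝ) ^ j *
            ∑ S ∈ (insert a P).powersetCard j, ∏ i ∈ S, x i =
          ∑ j ∈ Finset.range (T + 1), (-1) ^ j * ∑ S ∈ P.powersetCard j, ∏ i ∈ S, x i -
            x a * ∑ j ∈ Finset.range T, (-1) ^ j * ∑ S ∈ P.powersetCard j, ∏ i ∈ S, x i := by
        rw [Finset.sum_range_succ', Finset.sum_range_succ' _ T]
        simp only [key, Finset.powersetCard_zero, Finset.mul_sum (Finset.range T)]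
        rw [add_sub_right_comm, ← Finset.sum_sub_distrib]
        congr 1
        refine Finset.sum_congr rfl fun j _ => ?_
        ring
      rw [hs, key]
      generalize ∑ j ∈ Finset.range (T + 1), (-1 : ℝ) ^ j *
        ∑ S ∈ P.powersetCard j, ∏ i ∈ S, x i = A at *
      generalize ∑ j ∈ Finset.range T, (-1 : ℝ) ^ j *
        ∑ S ∈ P.powersetCard j, ∏ i ∈ S, x i = B at *
      generalize ∏ i ∈ P, (1 - x i) = p at *
      -- The new error is the old one at level `T + 1` minus `x a` times the old one at level `T`,
      -- matching the recursion of the elementary symmetric sums.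
      calc |(1 - x a) * p - (A - x a * B)| = |(p - A) - x a * (p - B)| := by ring_nf
        _ ≤ |p - A| + |x a * (p - B)| := abs_sub _ _
        _ ≤ _ := by
          rw [abs_mul, abs_of_nonneg ha0]
          gcongr

theorem pow_succ_add_le_add_pow_succ {s a : ℝ} (hs : 0 ≤ s) (ha : 0 ≤ a) (t : ℕ) :
    s ^ (t + 1) + (t + 1) * a * s ^ t ≤ (s + a) ^ (t + 1) := by
  induction t with
  | zero => simp
  | succ t ih =>
    have h := mul_le_mul_of_nonneg_right ih (add_nonneg hs ha)
    have h2 : 0 ≤ (t + 1) * a ^ 2 * s ^ t := by positivity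
    rw [pow_succ (s + a)]
    push_cast
    calc _ = (s ^ (t + 1) + (t + 1) * a * s ^ t) * (s + a) - (t + 1) * a ^ 2 * s ^ t := by ring
      _ ≤ _ := by linarith

/-- Each squarefree monomial of degree `T` occurs `T!` times in the expansion of the `T`-th power of
the sum. -/
theorem sum_powersetCard_prod_le {α : Type*} [DecidableEq α] (P : Finset α) (x : α → ℝ)
    (h0 : ∀ i ∈ P, 0 ≤ x i) (T : ℕ) :
    ∑ S ∈ P.powersetCard T, ∏ i ∈ S, x i ≤ (∑ i ∈ P, x i) ^ T / T.factorial := by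
  induction P using Finset.induction_on generalizing T with
  | empty =>
    cases T with
    | zero => simp
    | succ T =>
      have h : Finset.powersetCard (T + 1) (∅ : Finset α) = ∅ := by
        simp [Finset.powersetCard_eq_empty]
      simp [h]
  | insert a P ha ih =>
    have h0' : ∀ i ∈ P, 0 ≤ x i := fun i hi => h0 i (Finset.mem_insert_of_mem hi)
    have ha0 := h0 a (Finset.mem_insert_self _ _)
    have hs : 0 ≤ ∑ i ∈ P, x i := Finset.sum_nonneg h0'
    cases T with
    | zero => simp
    | succ T =>
      rw [sum_powersetCard_succ_insert_prod ha, Finset.sum_insert ha]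
      have e1 := ih h0' (T + 1)
      have e2 := ih h0' T
      generalize ∑ i ∈ P, x i = s at *
      have hp := pow_succ_add_le_add_pow_succ hs ha0 T
      calc _ ≤ s ^ (T + 1) / (T + 1).factorial + x a * (s ^ T / T.factorial) := by gcongr
        _ = (s ^ (T + 1) + (T + 1) * x a * s ^ T) / (T + 1).factorial := by
          rw [Nat.factorial_succ]
          push_cast
          field_simp
        _ ≤ (s + x a) ^ (T + 1) / (T + 1).factorial := by gcongr
        _ = _ := by rw [add_comm]

/-- If the events `E u` are independent in groups of at most `T`, and the product of the
probabilities of the complements is not too small, then all events can be avoided. -/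
theorem exists_forall_not_of_independent {α Ω : Type*} [DecidableEq α] [Fintype Ω] [Nonempty Ω]
    (P : Finset α) (E : α → Ω → Prop) [∀ u, DecidablePred (E u)] (x : α → ℝ) (T : ℕ)
    (h0 : ∀ i ∈ P, 0 ≤ x i) (h1 : ∀ i ∈ P, x i ≤ 1)
    (hind : ∀ S ⊆ P, S.card ≤ T →
      ((Finset.univ.filter fun ω => ∀ u ∈ S, E u ω).card : ℝ) =
        Fintype.card Ω * ∏ u ∈ S, x u)
    (hT : 2 * ((∑ i ∈ P, x i) ^ T / T.factorial) < ∏ i ∈ P, (1 - x i)) :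
    ∃ ω, ∀ u ∈ P, ¬ E u ω := by
  by_contra! hcon
  have hN : (0 : ℝ) < Fintype.card Ω := by exact_mod_cast Fintype.card_pos
  let y : Ω → α → ℝ := fun ω u => if E u ω then 1 else 0
  -- Under the contrary assumption some event always occurs, so the product of the complementary
  -- indicators vanishes identically.
  have hy0 : ∀ ω, ∏ i ∈ P, (1 - y ω i) = 0 := by
    intro ω
    obtain ⟨u, hu, hE⟩ := hcon ω
    exact Finset.prod_eq_zero hu (by simp [y, hE])
  have hexp : ∀ j ≤ T, ∑ ω, ∑ S ∈ P.powersetCard j, ∏ i ∈ S, y ω i =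
      Fintype.card Ω * ∑ S ∈ P.powersetCard j, ∏ i ∈ S, x i := by
    intro j hj
    rw [Finset.sum_comm, Finset.mul_sum]
    refine Finset.sum_congr rfl fun S hS => ?_
    obtain ⟨hSP, hSc⟩ := Finset.mem_powersetCard.1 hS
    rw [← hind S hSP (by omega), Finset.card_filter]
    push_cast
    refine Finset.sum_congr rfl fun ω _ => ?_
    simp only [y]
    rw [Finset.prod_ite_zero]
    simp
  -- Averaging the truncation bound for the indicators over `ω` turns their symmetric sums into
  -- those of `x`. The same truncated sum thus approximates both `0` and `∏ (1 - x i)`, each up to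
  -- the degree-`T` symmetric sum; hence the factor 2 in `hT`.
  have hA : |∑ j ∈ Finset.range T, (-1 : ℝ) ^ j * ∑ S ∈ P.powersetCard j, ∏ i ∈ S, x i| ≤
      ∑ S ∈ P.powersetCard T, ∏ i ∈ S, x i := by
    have h := fun ω => abs_prod_one_sub_sub_le P (y ω) (fun i _ => by simp only [y]; split_ifs <;> simp)
      (fun i _ => by simp only [y]; split_ifs <;> simp) T
    simp only [hy0, zero_sub, abs_neg] at h
    have h2 := (Finset.abs_sum_le_sum_abs _ _).trans (Finset.sum_le_sum fun ω (_ : ω ∈ Finset.univ) => h ω)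
    rw [hexp T le_rfl, Finset.sum_comm] at h2
    have : ∀ j ∈ Finset.range T, ∑ ω, (-1 : ℝ) ^ j * ∑ S ∈ P.powersetCard j, ∏ i ∈ S, y ω i =
        Fintype.card Ω * ((-1 : ℝ) ^ j * ∑ S ∈ P.powersetCard j, ∏ i ∈ S, x i) := by
      intro j hj
      rw [← Finset.mul_sum, hexp j (Finset.mem_range.1 hj).le]
      ring
    rw [Finset.sum_congr rfl this, ← Finset.mul_sum, abs_mul, abs_of_pos hN] at h2
    exact le_of_mul_le_mul_left h2 hN
  have hB := abs_prod_one_sub_sub_le P x h0 h1 T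
  have hC := sum_powersetCard_prod_le P x h0 T
  have := abs_le.1 hA
  have := abs_le.1 hB
  linarith

/-! ### Images under a random linear map. -/

/-- Summing a function along a surjective additive map of finite groups. -/
theorem card_mul_sum_comp_of_surjective {X Y : Type*} [AddCommGroup X] [AddCommGroup Y]
    [Fintype X] [Fintype Y] (f : X →+ Y) (hf : Function.Surjective f) (φ : Y → ℝ) :
    (Fintype.card Y : ℝ) * ∑ x, φ (f x) = Fintype.card X * ∑ y, φ y := by
  classical
  have hfib : ∀ y, (Finset.univ.filter fun x => f x = y).card =
      (Finset.univ.filter fun x => f x = 0).card := by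
    intro y
    obtain ⟨x₀, rfl⟩ := hf y
    refine Finset.card_bij (fun x _ => x - x₀) ?_ ?_ ?_
    · intro x hx
      simp_all
    · intro x _ x' _ h
      simpa using h
    · intro x hx
      refine ⟨x + x₀, ?_, ?_⟩ <;> simp_all
  have h1 : ∀ ψ : Y → ℝ, ∑ x, ψ (f x) =
      (Finset.univ.filter fun x => f x = 0).card * ∑ y, ψ y := by
    intro ψ
    rw [← Finset.sum_fiberwise (s := Finset.univ) (g := f), Finset.mul_sum]
    refine Finset.sum_congr rfl fun y _ => ?_
    rw [Finset.sum_congr rfl (g := fun _ => ψ y)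
      (fun x hx => by rw [(Finset.mem_filter.1 hx).2]), Finset.sum_const, hfib, nsmul_eq_mul]
  have h2 := h1 fun _ => 1
  simp only [Finset.sum_const, Finset.card_univ, nsmul_eq_mul, mul_one] at h2
  rw [h1 φ, h2]
  ring

/-- Under a uniformly random linear map, the images of linearly independent vectors are
independent and uniformly distributed. -/
theorem sum_linearMap_comp_linearIndependent {F V W σ : Type*} [Field F] [AddCommGroup V]
    [Module F V] [AddCommGroup W] [Module F W] [Fintype (V →ₗ[F] W)] [Fintype W] [Fintype σ]
    [DecidableEq σ] {v : σ → V} (hv : LinearIndependent F v) (φ : (σ → W) → ℝ) :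
    (Fintype.card W : ℝ) ^ Fintype.card σ * ∑ G : V →ₗ[F] W, φ (fun i => G (v i)) =
      Fintype.card (V →ₗ[F] W) * ∑ b : σ → W, φ b := by
  let f : (V →ₗ[F] W) →+ (σ → W) :=
    { toFun := fun G i => G (v i)
      map_zero' := rfl
      map_add' := fun _ _ => rfl }
  have hf : Function.Surjective f := by
    intro b
    obtain ⟨G, hG⟩ := LinearMap.exists_extend
      ((Module.Basis.span hv).constr F b)
    refine ⟨G, funext fun i => ?_⟩
    have := LinearMap.congr_fun hG (Module.Basis.span hv i)
    rw [Module.Basis.constr_basis] at this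
    rw [← this, LinearMap.comp_apply, Submodule.subtype_apply, Module.Basis.span_apply]
    rfl
  have := card_mul_sum_comp_of_surjective f hf φ
  rw [Fintype.card_fun] at this
  push_cast at this
  exact this

theorem sum_linearMap_apply {F V W : Type*} [Field F] [AddCommGroup V]
    [Module F V] [AddCommGroup W] [Module F W] [Fintype (V →ₗ[F] W)] [Fintype W]
    {u : V} (hu : u ≠ 0) (φ : W → ℝ) :
    (Fintype.card W : ℝ) * ∑ G : V →ₗ[F] W, φ (G u) =
      Fintype.card (V →ₗ[F] W) * ∑ b : W, φ b := by
  have h := sum_linearMap_comp_linearIndependent (W := W)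
    (LinearIndependent.of_subsingleton (R := F) (v := fun _ : Unit => u) () hu) fun b => φ (b ())
  simp only [Fintype.card_unit, pow_one] at h
  rw [h]
  congr 1
  exact Fintype.sum_equiv (Equiv.funUnique Unit W) _ _ fun b => rfl

/-! ### Sizes of Hamming balls. -/

theorem card_hammingNorm_eq {ι F : Type*} [Fintype ι] [DecidableEq ι] [Field F] [Fintype F]
    [DecidableEq F] (j : ℕ) :
    (Finset.univ.filter fun x : ι → F => hammingNorm x = j).card =
      (Fintype.card ι).choose j * (Fintype.card F - 1) ^ j := by
  have h : (Finset.univ.filter fun x : ι → F => hammingNorm x = j) =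
      (Finset.univ.powersetCard j).biUnion fun S : Finset ι =>
        Fintype.piFinset fun i => if i ∈ S then Finset.univ.erase 0 else {0} := by
    ext x
    simp only [Finset.mem_filter, Finset.mem_univ, true_and, Finset.mem_biUnion,
      Finset.mem_powersetCard, Finset.subset_univ, Fintype.mem_piFinset, hammingNorm]
    constructor
    · intro hx
      refine ⟨_, hx, fun i => ?_⟩
      by_cases hi : x i = 0 <;> simp [hi]
    · rintro ⟨S, hS, hx⟩
      rw [← hS]
      congr 1
      ext i
      have := hx i
      by_cases hi : i ∈ S <;> simp_all
  rw [h, Finset.card_biUnion]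
  · rw [Finset.sum_congr rfl (g := fun _ => (Fintype.card F - 1) ^ j)]
    · simp
    · intro S hS
      rw [Fintype.card_piFinset]
      rw [← (Finset.mem_powersetCard.1 hS).2]
      have : ∀ i, (if i ∈ S then Finset.univ.erase (0 : F) else {0}).card =
          if i ∈ S then (Fintype.card F - 1) else 1 := by
        intro i
        split_ifs <;> simp
      simp [this]
  · intro S hS S' hS' hne
    rw [Function.onFun, Finset.disjoint_left]
    intro x hx hx'
    apply hne
    rw [Fintype.mem_piFinset] at hx hx'
    ext i
    have h1 := hx i
    have h2 := hx' i
    by_cases a : i ∈ S <;> by_cases b : i ∈ S' <;> simp_all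

/-- The number of words of weight less than `r` in `F ^ m`, where `F` has `q` elements. -/
def ballSum (q m r : ℕ) : ℝ := ∑ i ∈ Finset.range r, (m.choose i : ℝ) * ((q : ℝ) - 1) ^ i

theorem card_hammingNorm_lt {ι F : Type*} [Fintype ι] [DecidableEq ι] [Field F] [Fintype F]
    [DecidableEq F] (r : ℕ) :
    ((Finset.univ.filter fun x : ι → F => hammingNorm x < r).card : ℝ) =
      ballSum (Fintype.card F) (Fintype.card ι) r := by
  have h := Finset.card_eq_sum_card_fiberwise (f := fun x : ι → F => hammingNorm x)
    (s := Finset.univ.filter fun x : ι → F => hammingNorm x < r) (t := Finset.range r)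
    (fun x hx => by simpa using hx)
  rw [h, ballSum]
  push_cast
  refine Finset.sum_congr rfl fun i hi => ?_
  have h2 := card_hammingNorm_eq (ι := ι) (F := F) i
  rw [Finset.filter_filter]
  rw [show (Finset.univ.filter fun x : ι → F => hammingNorm x < r ∧ hammingNorm x = i) =
    Finset.univ.filter fun x : ι → F => hammingNorm x = i from Finset.filter_congr fun x _ =>
      ⟨fun h => h.2, fun h => ⟨h ▸ Finset.mem_range.1 hi, h⟩⟩, h2]
  rw [Nat.cast_mul, Nat.cast_pow, Nat.cast_sub Fintype.card_pos, Nat.cast_one]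

theorem ballSum_nonneg {q : ℕ} (hq : 1 ≤ q) (m r : ℕ) : 0 ≤ ballSum q m r := by
  have : (1 : ℝ) ≤ q := by exact_mod_cast hq
  have : (0 : ℝ) ≤ (q : ℝ) - 1 := by linarith
  unfold ballSum
  positivity

theorem one_le_ballSum {q : ℕ} (hq : 1 ≤ q) (m : ℕ) {r : ℕ} (hr : 1 ≤ r) :
    1 ≤ ballSum q m r := by
  have h1 : (1 : ℝ) ≤ q := by exact_mod_cast hq
  have h2 : (0 : ℝ) ≤ (q : ℝ) - 1 := by linarith
  have := Finset.single_le_sum (f := fun i => (m.choose i : ℝ) * ((q : ℝ) - 1) ^ i)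
    (fun i _ => by positivity) (Finset.mem_range.2 hr)
  simpa [ballSum] using this

theorem ballSum_mono {q : ℕ} (hq : 1 ≤ q) {m m' : ℕ} (h : m ≤ m') (r : ℕ) :
    ballSum q m r ≤ ballSum q m' r := by
  have h1 : (1 : ℝ) ≤ q := by exact_mod_cast hq
  have h2 : (0 : ℝ) ≤ (q : ℝ) - 1 := by linarith
  unfold ballSum
  gcongr

theorem hammingNorm_sumElim {ι κ F : Type*} [Fintype ι] [Fintype κ] [Zero F] [DecidableEq F]
    (x : ι → F) (y : κ → F) :
    hammingNorm (Sum.elim x y) = hammingNorm x + hammingNorm y := by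
  simp only [hammingNorm, Finset.card_filter]
  rw [Fintype.sum_sum_type]
  rfl

theorem card_prod_hammingNorm_lt {ι κ F : Type*} [Fintype ι] [Fintype κ] [DecidableEq ι]
    [DecidableEq κ] [Field F] [Fintype F] [DecidableEq F] (r : ℕ) :
    ((Finset.univ.filter fun z : (ι → F) × (κ → F) =>
        hammingNorm z.1 + hammingNorm z.2 < r).card : ℝ) =
      ballSum (Fintype.card F) (Fintype.card ι + Fintype.card κ) r := by
  classical
  rw [← Fintype.card_sum, ← card_hammingNorm_lt]
  congr 1
  refine Finset.card_equiv (Equiv.sumArrowEquivProdArrow ι κ F).symm fun z => ?_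
  obtain ⟨x, y⟩ := z
  simp [Equiv.sumArrowEquivProdArrow, hammingNorm_sumElim]

/-- Shortening the length and the radius by one. -/
theorem ballSum_pred_le {q m r : ℕ} (hq : 1 ≤ q) :
    ((m : ℝ) + 1) * ((q : ℝ) - 1) * ballSum q m r ≤ r * ballSum q (m + 1) (r + 1) := by
  have h1 : (1 : ℝ) ≤ q := by exact_mod_cast hq
  have h2 : (0 : ℝ) ≤ (q : ℝ) - 1 := by linarith
  have h3 : ∑ i ∈ Finset.range r, ((m + 1).choose (i + 1) : ℝ) * ((q : ℝ) - 1) ^ (i + 1) ≤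
      ballSum q (m + 1) (r + 1) := by
    rw [ballSum, Finset.sum_range_succ']
    simp
  refine le_trans ?_ (mul_le_mul_of_nonneg_left h3 (Nat.cast_nonneg r))
  rw [ballSum, Finset.mul_sum, Finset.mul_sum]
  refine Finset.sum_le_sum fun i hi => ?_
  have h4 : ((m : ℝ) + 1) * m.choose i = (m + 1).choose (i + 1) * (i + 1) := by
    exact_mod_cast Nat.add_one_mul_choose_eq m i
  have h5 : ((i : ℝ) + 1) ≤ r := by exact_mod_cast Finset.mem_range.1 hi
  calc _ = (((m : ℝ) + 1) * m.choose i) * ((q : ℝ) - 1) ^ (i + 1) := by ring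
    _ = (i + 1) * (((m + 1).choose (i + 1)) * ((q : ℝ) - 1) ^ (i + 1)) := by rw [h4]; ring
    _ ≤ _ := by gcongr

/-- Iterates `ballSum_pred_le`: each shortening costs a factor radius/length, which stays at most
`δ` because `δ ≤ 1`. -/
theorem ballSum_sub_le {q : ℕ} (hq : 1 ≤ q) {δ : ℝ} (hδ : 0 ≤ δ) (hδ1 : δ ≤ 1) (m r s : ℕ)
    (h : (r + s : ℝ) ≤ δ * (m + s)) :
    ((q : ℝ) - 1) ^ s * ballSum q m r ≤ δ ^ s * ballSum q (m + s) (r + s) := by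
  have h1 : (1 : ℝ) ≤ q := by exact_mod_cast hq
  have h2 : (0 : ℝ) ≤ (q : ℝ) - 1 := by linarith
  induction s with
  | zero => simp
  | succ s ih =>
    push_cast at h
    have ih := ih (by nlinarith)
    have hp := ballSum_pred_le (m := m + s) (r := r + s) hq
    have hb := ballSum_nonneg hq (m + s + 1) (r + s + 1)
    push_cast at hp
    have hpos : (0 : ℝ) < (m : ℝ) + s + 1 := by positivity
    have h6 : ((q : ℝ) - 1) * ballSum q (m + s) (r + s) ≤
        δ * ballSum q (m + s + 1) (r + s + 1) := by
      refine le_of_mul_le_mul_left ?_ hpos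
      calc _ = ((m : ℝ) + s + 1) * ((q : ℝ) - 1) * ballSum q (m + s) (r + s) := by ring
        _ ≤ _ := hp
        _ ≤ (δ * (m + s + 1)) * ballSum q (m + s + 1) (r + s + 1) := by
          refine mul_le_mul_of_nonneg_right ?_ hb
          linarith
        _ = _ := by ring
    calc _ = ((q : ℝ) - 1) * (((q : ℝ) - 1) ^ s * ballSum q m r) := by ring
      _ ≤ ((q : ℝ) - 1) * (δ ^ s * ballSum q (m + s) (r + s)) := by gcongr
      _ = δ ^ s * (((q : ℝ) - 1) * ballSum q (m + s) (r + s)) := by ring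
      _ ≤ δ ^ s * (δ * ballSum q (m + s + 1) (r + s + 1)) := by gcongr
      _ = _ := by rw [← add_assoc, ← add_assoc]; ring

/-- The most likely value of a binomial variable whose mean `d` is an integer is `d`. -/
theorem pow_le_succ_mul_choose_mul {n d : ℕ} (hd : d < n) :
    n ^ n ≤ (n + 1) * (n.choose d * (d ^ d * (n - d) ^ (n - d))) := by
  -- The binomial terms with parameter `d / n`, scaled by `n ^ n`. Their consecutive ratios show
  -- that they rise up to `d` and fall afterwards, so `b d` is at least the average of the `n + 1`
  -- terms.
  let b : ℕ → ℕ := fun i => n.choose i * (d ^ i * (n - d) ^ (n - i))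
  have hrec : ∀ i < n, b (i + 1) * ((i + 1) * (n - d)) = b i * ((n - i) * d) := by
    intro i hi
    have h1 := Nat.choose_succ_right_eq n i
    have h2 : (n - d) ^ (n - i) = (n - d) ^ (n - (i + 1)) * (n - d) := by
      rw [← pow_succ]
      congr 1
      omega
    simp only [b]
    rw [h2, pow_succ]
    calc _ = (n.choose (i + 1) * (i + 1)) * (d ^ i * d * ((n - d) ^ (n - (i + 1)) * (n - d))) := by
          ring
      _ = _ := by rw [h1]; ring
  have hup : ∀ i, i + 1 ≤ d → b i ≤ b (i + 1) := by
    intro i hi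
    have h := hrec i (by omega)
    have hle : (i + 1) * (n - d) ≤ (n - i) * d := by
      zify [hd.le, show i ≤ n by omega]
      have : (i : ℤ) + 1 ≤ d := by exact_mod_cast hi
      have : (d : ℤ) < n := by exact_mod_cast hd
      nlinarith
    have hpos : 0 < (n - i) * d := Nat.mul_pos (by omega) (by omega)
    refine Nat.le_of_mul_le_mul_right ?_ hpos
    rw [← h]
    exact Nat.mul_le_mul_left _ hle
  have hdown : ∀ i, d ≤ i → i < n → b (i + 1) ≤ b i := by
    intro i hi hin
    have h := hrec i hin
    have hle : (n - i) * d ≤ (i + 1) * (n - d) := by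
      zify [hd.le, hin.le]
      have : (d : ℤ) ≤ i := by exact_mod_cast hi
      have : (d : ℤ) < n := by exact_mod_cast hd
      nlinarith
    have hpos : 0 < (i + 1) * (n - d) := Nat.mul_pos (by omega) (by omega)
    refine Nat.le_of_mul_le_mul_right ?_ hpos
    rw [h]
    exact Nat.mul_le_mul_left _ hle
  have hmax : ∀ i ≤ n, b i ≤ b d := by
    intro i hi
    rcases le_total i d with h | h
    · have : ∀ j, i ≤ j → j ≤ d → b i ≤ b j := by
        intro j hj
        induction j, hj using Nat.le_induction with
        | base => exact fun _ => le_rfl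
        | succ j hj ih => exact fun hjd => (ih (by omega)).trans (hup j hjd)
      exact this d h le_rfl
    · induction i, h using Nat.le_induction with
      | base => exact le_rfl
      | succ i h ih => exact (hdown i h (by omega)).trans (ih (by omega))
  have hsum := add_pow d (n - d) n
  rw [Nat.add_sub_cancel' hd.le] at hsum
  calc n ^ n = ∑ i ∈ Finset.range (n + 1), b i := by
        rw [hsum]
        refine Finset.sum_congr rfl fun i _ => ?_
        simp only [b, Nat.cast_id]
        ring
    _ ≤ ∑ i ∈ Finset.range (n + 1), b d :=
        Finset.sum_le_sum fun i hi => hmax i (Nat.lt_succ_iff.1 (Finset.mem_range.1 hi))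
    _ = _ := by simp [b]

theorem one_le_succ_mul_choose_mul {n d : ℕ} {δ : ℝ} (hd : d < n) (hδ : (d : ℝ) = δ * n) :
    1 ≤ ((n : ℝ) + 1) * (n.choose d * (δ ^ d * (1 - δ) ^ (n - d))) := by
  have hn : (0 : ℝ) < n := by exact_mod_cast (Nat.zero_le d).trans_lt hd
  have h := pow_le_succ_mul_choose_mul hd
  have h' : (n : ℝ) ^ n ≤ (n + 1) * (n.choose d * ((δ * n) ^ d * ((1 - δ) * n) ^ (n - d))) := by
    rw [show (1 - δ) * (n : ℝ) = (n - d : ℕ) by rw [Nat.cast_sub hd.le, hδ]; ring, ← hδ]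
    exact_mod_cast h
  rw [mul_pow, mul_pow] at h'
  have e : (n : ℝ) ^ n = (n : ℝ) ^ d * (n : ℝ) ^ (n - d) := by
    rw [← pow_add, Nat.add_sub_cancel' hd.le]
  refine le_of_mul_le_mul_right ?_ (pow_pos hn n)
  rw [one_mul]
  refine h'.trans (le_of_eq ?_)
  rw [e]
  ring

/-- A lower bound for the size of a Hamming ball which is sharp up to polynomial factors. -/
theorem pow_le_ballSum {q n d : ℕ} {δ t : ℝ} (hq : 2 ≤ q) (hδ0 : 0 < δ) (hδ1 : δ < 1)
    (hd0 : 1 ≤ d) (hδ : (d : ℝ) = δ * n) (ht : t ^ 2 * ((q : ℝ) - 1) * (1 - δ) = δ) :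
    (1 / (1 - δ)) ^ n ≤ (n + 1) * n * q * ballSum q n d * t ^ (2 * d) := by
  have hn : 0 < n := by
    rcases Nat.eq_zero_or_pos n with h | h
    · subst h
      simp at hδ
      omega
    · exact h
  have hn' : (0 : ℝ) < n := by exact_mod_cast hn
  have hdn : d < n := by
    have : (d : ℝ) < n := by rw [hδ]; nlinarith
    exact_mod_cast this
  have hq' : (2 : ℝ) ≤ q := by exact_mod_cast hq
  have h1δ : 0 < 1 - δ := by linarith
  have h1 := one_le_succ_mul_choose_mul hdn hδ
  obtain ⟨e, rfl⟩ : ∃ e, d = e + 1 := ⟨d - 1, by omega⟩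
  -- The ball contains only weights up to `d - 1 = e`; passing from the binomial term at `d` to the
  -- one at `e` accounts for the factor `n * q`.
  have h2 : (n.choose (e + 1) : ℝ) ≤ n * n.choose e := by
    have := Nat.choose_succ_right_eq n e
    have h3 : n.choose (e + 1) ≤ n.choose e * n := by
      calc n.choose (e + 1) ≤ n.choose (e + 1) * (e + 1) := Nat.le_mul_of_pos_right _ (by omega)
        _ = n.choose e * (n - e) := this
        _ ≤ _ := Nat.mul_le_mul_left _ (Nat.sub_le _ _)
    rw [mul_comm]
    exact_mod_cast h3
  have h3 : (n.choose e : ℝ) * ((q : ℝ) - 1) ^ e ≤ ballSum q n (e + 1) :=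
    Finset.single_le_sum (f := fun i => (n.choose i : ℝ) * ((q : ℝ) - 1) ^ i)
      (fun i _ => mul_nonneg (Nat.cast_nonneg _) (pow_nonneg (by linarith) _))
      (Finset.mem_range.2 (Nat.lt_succ_self e))
  have hq1 : 0 < (q : ℝ) - 1 := by linarith
  have ht0 : 0 ≤ t ^ (2 * (e + 1)) := by rw [pow_mul]; positivity
  have key : (n.choose (e + 1) : ℝ) * ((q : ℝ) - 1) ^ (e + 1) ≤
      n * q * ballSum q n (e + 1) := by
    calc _ ≤ (n * n.choose e : ℝ) * ((q : ℝ) - 1) ^ (e + 1) := by gcongr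
      _ = n * ((q : ℝ) - 1) * ((n.choose e : ℝ) * ((q : ℝ) - 1) ^ e) := by ring
      _ ≤ n * q * ballSum q n (e + 1) := by
        gcongr
        linarith
  have e1 : δ ^ (e + 1) * (1 - δ) ^ (n - (e + 1)) =
      ((q : ℝ) - 1) ^ (e + 1) * t ^ (2 * (e + 1)) * (1 - δ) ^ n := by
    have : (1 - δ) ^ n = (1 - δ) ^ (e + 1) * (1 - δ) ^ (n - (e + 1)) := by
      rw [← pow_add, Nat.add_sub_cancel' hdn.le]
    rw [this, pow_mul, ← mul_assoc, ← mul_pow, ← mul_pow]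
    congr 2
    linear_combination -ht
  rw [e1] at h1
  rw [one_div, inv_pow, inv_le_iff_one_le_mul₀ (by positivity)]
  calc (1 : ℝ) ≤ _ := h1
    _ = ((n : ℝ) + 1) * ((n.choose (e + 1) : ℝ) * ((q : ℝ) - 1) ^ (e + 1)) *
        t ^ (2 * (e + 1)) * (1 - δ) ^ n := by ring
    _ ≤ ((n : ℝ) + 1) * (n * q * ballSum q n (e + 1)) *
        t ^ (2 * (e + 1)) * (1 - δ) ^ n := by gcongr
    _ = _ := by ring

/-! ### Low-weight pairs with a low-weight combination, by exponential moments. -/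

theorem prod_ite_eq_pow_hammingNorm {ι F : Type*} [Fintype ι] [Zero F] [DecidableEq F] (x : ι → F) (t : ℝ) :
    ∏ i, (if x i = 0 then 1 else t) = t ^ hammingNorm x := by
  rw [Finset.prod_ite]
  simp [hammingNorm]

section PairCount

variable {F : Type*} [Field F] [Fintype F] [DecidableEq F]

theorem sum_sq_ite (t : ℝ) : ∑ x : F, (if x = 0 then 1 else t) ^ 2 =
    1 + ((Fintype.card F : ℝ) - 1) * t ^ 2 := by
  rw [← Finset.add_sum_erase _ _ (Finset.mem_univ (0 : F))]
  rw [Finset.sum_congr rfl (g := fun _ => t ^ 2)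
    (fun x hx => by rw [if_neg (Finset.ne_of_mem_erase hx)])]
  rw [Finset.sum_const, Finset.card_erase_of_mem (Finset.mem_univ _), Finset.card_univ, nsmul_eq_mul,
    Nat.cast_sub Fintype.card_pos]
  simp

/-- With `f = 1` at `0` and `t` elsewhere, the sum is `∑ f²` minus half of `∑ (f(x) - f(ax+c))²`.
For `c ≠ 0` the two factors peak at different points, `0` and `-c/a`, and each point contributes `(1
- t)²` to the squared difference. -/
theorem sum_ite_mul_ite_le {a : F} (ha : a ≠ 0) (c : F) (t : ℝ) :
    ∑ x : F, (if x = 0 then 1 else t) * (if a * x + c = 0 then 1 else t) ≤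
      1 + ((Fintype.card F : ℝ) - 1) * t ^ 2 - if c = 0 then 0 else (1 - t) ^ 2 := by
  have hinj : Function.Bijective fun x : F => a * x + c := by
    refine (Finite.injective_iff_bijective).1 fun x y h => ?_
    simpa [ha] using h
  have h1 := sum_sq_ite (F := F) t
  have h2 : ∑ x : F, (if a * x + c = 0 then 1 else t) ^ 2 =
      1 + ((Fintype.card F : ℝ) - 1) * t ^ 2 := by
    rw [← h1]
    exact hinj.sum_comp fun x : F => (if x = 0 then 1 else t : ℝ) ^ 2
  have h3 : ∑ x : F, ((if x = 0 then 1 else t) - (if a * x + c = 0 then 1 else t)) ^ 2 =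
      2 * (1 + ((Fintype.card F : ℝ) - 1) * t ^ 2) -
        2 * ∑ x : F, (if x = 0 then 1 else t) * (if a * x + c = 0 then 1 else t) := by
    rw [two_mul, two_mul]
    nth_rewrite 1 [← h1]
    rw [← h2, ← two_mul, Finset.mul_sum, ← Finset.sum_add_distrib, ← Finset.sum_sub_distrib]
    refine Finset.sum_congr rfl fun x _ => ?_
    ring
  suffices h : 2 * (if c = 0 then 0 else (1 - t) ^ 2) ≤
      ∑ x : F, ((if x = 0 then 1 else t) - (if a * x + c = 0 then 1 else t)) ^ 2 by linarith
  split_ifs with hc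
  · simp only [mul_zero]
    positivity
  · have hne : (0 : F) ≠ -c / a := by
      intro h
      rcases div_eq_zero_iff.1 h.symm with h | h
      · exact hc (neg_eq_zero.1 h)
      · exact ha h
    have := Finset.sum_le_sum_of_subset_of_nonneg (Finset.subset_univ ({0, -c / a} : Finset F))
      (f := fun x : F => ((if x = 0 then 1 else t) - (if a * x + c = 0 then 1 else t) : ℝ) ^ 2)
      (fun x _ _ => sq_nonneg _)
    rw [Finset.sum_pair hne] at this
    have e : a * (-c / a) + c = 0 := by field_simp; ring
    simp only [mul_zero, zero_add, hc, if_true, if_false, e, hne.symm] at this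
    linarith [sq_nonneg (1 - t)]

/-- The saving of `sum_ite_mul_ite_le` is lost only at the single `y` with `b y + z = 0`, whose
weight is at most 1. The square on the factor in `y` makes the weighted sum over `y` equal to the
same quantity `A`. -/
theorem sum_sum_ite_le {a b : F} (ha : a ≠ 0) (hb : b ≠ 0) (z : F) {t : ℝ} (ht0 : 0 ≤ t)
    (ht1 : t ≤ 1) :
    ∑ y : F, (if y = 0 then 1 else t) ^ 2 *
        ∑ x : F, (if x = 0 then 1 else t) * (if a * x + (b * y + z) = 0 then 1 else t) ≤
      (1 + ((Fintype.card F : ℝ) - 1) * t ^ 2) ^ 2 -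
        (1 - t) ^ 2 * (((Fintype.card F : ℝ) - 1) * t ^ 2) := by
  have h1 := sum_sq_ite (F := F) t
  set A := 1 + ((Fintype.card F : ℝ) - 1) * t ^ 2 with hA
  have hstep : ∀ y : F, (if y = 0 then 1 else t) ^ 2 *
        ∑ x : F, (if x = 0 then 1 else t) * (if a * x + (b * y + z) = 0 then 1 else t) ≤
      (if y = 0 then 1 else t) ^ 2 * (A - (1 - t) ^ 2) +
        if y = -z / b then (1 - t) ^ 2 else 0 := by
    intro y
    have hw : ((if y = 0 then 1 else t : ℝ)) ^ 2 ≤ 1 := by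
      split_ifs
      · simp
      · nlinarith
    refine (mul_le_mul_of_nonneg_left (sum_ite_mul_ite_le ha (b * y + z) t) (sq_nonneg _)).trans ?_
    by_cases hy : y = -z / b
    · have : b * y + z = 0 := by rw [hy]; field_simp; ring
      rw [if_pos this, if_pos hy]
      nlinarith [sq_nonneg (1 - t)]
    · have : b * y + z ≠ 0 := fun h => hy (by rw [eq_div_iff hb]; linear_combination h)
      rw [if_neg this, if_neg hy]
      linarith
  refine (Finset.sum_le_sum fun y _ => hstep y).trans ?_
  rw [Finset.sum_add_distrib, ← Finset.sum_mul, h1, Finset.sum_ite_eq' Finset.univ,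
    if_pos (Finset.mem_univ _)]
  have : ((Fintype.card F : ℝ) - 1) * t ^ 2 = A - 1 := by rw [hA]; ring
  rw [this]
  linarith

/-- Few pairs of low weight words have a low weight combination. -/
theorem card_pair_mul_pow_le {ι : Type*} [Fintype ι] [DecidableEq ι] {a b : F} (ha : a ≠ 0)
    (hb : b ≠ 0) (z : ι → F) {t : ℝ} (ht0 : 0 < t) (ht1 : t ≤ 1) (d : ℕ) :
    ((Finset.univ.filter fun p : (ι → F) × (ι → F) => hammingNorm p.1 < d ∧
        hammingNorm p.2 < d ∧ hammingNorm (a • p.1 + (b • p.2 + z)) < d).card : ℝ) *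
        t ^ (4 * d) ≤
      ((1 + ((Fintype.card F : ℝ) - 1) * t ^ 2) ^ 2 -
        (1 - t) ^ 2 * (((Fintype.card F : ℝ) - 1) * t ^ 2)) ^ Fintype.card ι := by
  have h1 : ((Finset.univ.filter fun p : (ι → F) × (ι → F) => hammingNorm p.1 < d ∧
        hammingNorm p.2 < d ∧ hammingNorm (a • p.1 + (b • p.2 + z)) < d).card : ℝ) *
        t ^ (4 * d) ≤ ∑ p : (ι → F) × (ι → F), t ^ (2 * hammingNorm p.2) *
          (t ^ hammingNorm p.1 * t ^ hammingNorm (a • p.1 + (b • p.2 + z))) := by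
    -- Every counted pair contributes at least `t^(4d)`, since the total exponent, with the weight
    -- of `p.2` counted twice, is at most `4d` and `t ≤ 1`. The resulting sum factors over
    -- coordinates.
    rw [← nsmul_eq_mul, ← Finset.sum_const]
    refine (Finset.sum_le_sum fun p hp => ?_).trans
      (Finset.sum_le_sum_of_subset_of_nonneg (Finset.filter_subset _ _)
        fun p _ _ => by positivity)
    rw [← pow_add, ← pow_add]
    have := (Finset.mem_filter.1 hp).2
    exact pow_le_pow_of_le_one ht0.le ht1 (by omega)
  refine h1.trans ?_
  rw [Fintype.sum_prod_type_right]
  have h2 : ∀ y : ι → F, ∑ x : ι → F, t ^ (2 * hammingNorm y) *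
          (t ^ hammingNorm x * t ^ hammingNorm (a • x + (b • y + z))) =
      ∏ i, ((if y i = 0 then 1 else t) ^ 2 * ∑ x : F, (if x = 0 then 1 else t) *
        (if a * x + (b * y i + z i) = 0 then 1 else t)) := by
    intro y
    rw [Finset.prod_mul_distrib, Finset.prod_pow, prod_ite_eq_pow_hammingNorm, Finset.prod_univ_sum,
      Fintype.piFinset_univ, ← Finset.mul_sum, ← pow_mul, mul_comm 2]
    congr 1
    refine Finset.sum_congr rfl fun x _ => ?_
    rw [Finset.prod_mul_distrib, prod_ite_eq_pow_hammingNorm]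
    congr 1
    rw [← prod_ite_eq_pow_hammingNorm]
    rfl
  simp only [h2]
  have h3 := Finset.prod_univ_sum (R := ℝ) (fun _ : ι => (Finset.univ : Finset F))
    (fun i y => (if y = 0 then 1 else t) ^ 2 * ∑ x : F, (if x = 0 then 1 else t) *
        (if a * x + (b * y + z i) = 0 then 1 else t))
  rw [Fintype.piFinset_univ] at h3
  rw [← h3]
  calc _ ≤ ∏ i : ι, ((1 + ((Fintype.card F : ℝ) - 1) * t ^ 2) ^ 2 -
        (1 - t) ^ 2 * (((Fintype.card F : ℝ) - 1) * t ^ 2)) := by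
        refine Finset.prod_le_prod (fun i _ => ?_) fun i _ => sum_sum_ite_le ha hb (z i) ht0.le ht1
        refine Finset.sum_nonneg fun y _ => mul_nonneg (sq_nonneg _)
          (Finset.sum_nonneg fun x _ => mul_nonneg ?_ ?_) <;> split_ifs <;> linarith
    _ = _ := by simp

end PairCount

/-- Once all vectors except the first two are fixed, their combination plays the role of `z` in the
pair count; the remaining `m` vectors range freely over the ball. -/
theorem card_combination_le {ι F : Type*} [Fintype ι] [DecidableEq ι] [Field F] [Fintype F]
    [DecidableEq F] {m d N : ℕ} (a : Fin (m + 2) → F)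
    (hN : ∀ z : ι → F, (Finset.univ.filter fun p : (ι → F) × (ι → F) => hammingNorm p.1 < d ∧
        hammingNorm p.2 < d ∧ hammingNorm (a 0 • p.1 + (a 1 • p.2 + z)) < d).card ≤ N) :
    (Finset.univ.filter fun b : Fin (m + 2) → ι → F =>
        (∀ i, hammingNorm (b i) < d) ∧ hammingNorm (∑ i, a i • b i) < d).card ≤
      N * (Finset.univ.filter fun x : ι → F => hammingNorm x < d).card ^ m := by
  have h := Finset.card_le_mul_card_image_of_maps_to
    (s := Finset.univ.filter fun b : Fin (m + 2) → ι → F =>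
        (∀ i, hammingNorm (b i) < d) ∧ hammingNorm (∑ i, a i • b i) < d)
    (t := Fintype.piFinset fun _ : Fin m => Finset.univ.filter fun x : ι → F => hammingNorm x < d)
    (f := fun b i => b i.succ.succ) (fun b hb => by
      have := (Finset.mem_filter.1 hb).2.1
      simp [this]) N ?_
  · simpa using h
  · intro c hc
    refine le_trans ?_ (hN (∑ i : Fin m, a i.succ.succ • c i))
    refine Finset.card_le_card_of_injOn (fun b => (b 0, b 1)) ?_ ?_
    · intro b hb
      simp only [Finset.coe_filter, Finset.mem_filter, Finset.mem_univ, true_and,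
        Set.mem_ofPred_eq] at hb ⊢
      obtain ⟨⟨h1, h2⟩, rfl⟩ := hb
      refine ⟨h1 0, h1 1, ?_⟩
      rw [Fin.sum_univ_succ, Fin.sum_univ_succ] at h2
      exact h2
    · intro b hb b' hb' hbb
      simp only [Finset.coe_filter, Finset.mem_filter, Finset.mem_univ, true_and,
        Set.mem_ofPred_eq] at hb hb'
      simp only [Prod.mk.injEq] at hbb
      funext i
      refine Fin.cases hbb.1 (fun i => Fin.cases hbb.2 (fun i => ?_) i) i
      exact congrFun (hb.2.trans hb'.2.symm) i

/-! ### Extending by a few random coordinates. -/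

/-- For `x ≤ 1/2` use `exp(-2x) ≤ 1 - x`; for larger `x`, the left side is at most `exp(-s) ≤
2^(-s)`. It bounds `∏ (1 - x)` from below although some `x` may be close to 1. -/
theorem exp_neg_le_one_sub {x : ℝ} {s : ℕ} (hs : 1 ≤ s) (h0 : 0 ≤ x)
    (h1 : (1 / 2 : ℝ) ^ s ≤ 1 - x) : Real.exp (-(2 * s * x)) ≤ 1 - x := by
  have hs' : (1 : ℝ) ≤ s := by exact_mod_cast hs
  rcases le_total x (1 / 2) with h | h
  · have h2 : Real.exp (-(2 * s * x)) ≤ Real.exp (-(2 * x)) := by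
      apply Real.exp_le_exp.2
      nlinarith
    refine h2.trans ?_
    rw [Real.exp_neg, inv_le_iff_one_le_mul₀ (Real.exp_pos _)]
    have := Real.add_one_le_exp (2 * x)
    calc 1 ≤ (1 - x) * (2 * x + 1) := by nlinarith
      _ ≤ _ := by
        refine mul_le_mul_of_nonneg_left this (by linarith [pow_pos (show (0:ℝ) < 1/2 by norm_num) s])
  · refine le_trans ?_ h1
    have h2 : Real.exp (-(2 * s * x)) ≤ Real.exp (-(s : ℝ)) := by
      apply Real.exp_le_exp.2
      nlinarith
    refine h2.trans ?_
    have h3 : Real.exp (-(s : ℝ)) = Real.exp (-1) ^ s := by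
      rw [← Real.exp_nat_mul]
      ring_nf
    rw [h3]
    gcongr
    rw [Real.exp_neg, one_div]
    gcongr
    linarith [Real.add_one_le_exp (1 : ℝ)]

/-- The proportion of words `y` of `F ^ κ` for which `w + hammingNorm y < d`. -/
noncomputable def badRatio (F κ : Type*) [Fintype κ] [DecidableEq κ] [Field F] [Fintype F] [DecidableEq F]
    (d w : ℕ) : ℝ :=
  ((Finset.univ.filter fun y : κ → F => w + hammingNorm y < d).card : ℝ) /
    (Fintype.card F : ℝ) ^ Fintype.card κ

section

variable {F κ : Type*} [Fintype κ] [DecidableEq κ] [Field F] [Fintype F] [DecidableEq F]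

theorem badRatio_nonneg (d w : ℕ) : 0 ≤ badRatio F κ d w := by
  unfold badRatio
  positivity

/-- Words with no zero coordinate are never bad here, and their proportion is `(1 - 1/q)^s` with `q
≥ 2`. -/
theorem half_pow_le_one_sub_badRatio {d w : ℕ} (h : d ≤ w + Fintype.card κ) :
    (1 / 2 : ℝ) ^ Fintype.card κ ≤ 1 - badRatio F κ d w := by
  have h1 := card_hammingNorm_eq (ι := κ) (F := F) (Fintype.card κ)
  have hq : (2 : ℝ) ≤ Fintype.card F := by exact_mod_cast Fintype.one_lt_card
  have hdis : Disjoint (Finset.univ.filter fun y : κ → F => w + hammingNorm y < d)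
      (Finset.univ.filter fun y : κ → F => hammingNorm y = Fintype.card κ) := by
    rw [Finset.disjoint_left]
    intro y hy hy'
    have := (Finset.mem_filter.1 hy).2
    have := (Finset.mem_filter.1 hy').2
    omega
  have h2 := Finset.card_le_univ ((Finset.univ.filter fun y : κ → F => w + hammingNorm y < d) ∪
      (Finset.univ.filter fun y : κ → F => hammingNorm y = Fintype.card κ))
  rw [Finset.card_union_of_disjoint hdis, h1, Nat.choose_self, one_mul, Fintype.card_fun] at h2
  have h3 : ((Finset.univ.filter fun y : κ → F => w + hammingNorm y < d).card : ℝ) +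
      ((Fintype.card F : ℝ) - 1) ^ Fintype.card κ ≤ (Fintype.card F : ℝ) ^ Fintype.card κ := by
    have : ((Fintype.card F - 1 : ℕ) : ℝ) = (Fintype.card F : ℝ) - 1 := by
      rw [Nat.cast_sub Fintype.card_pos, Nat.cast_one]
    rw [← this]
    exact_mod_cast h2
  have hqp : (0 : ℝ) < (Fintype.card F : ℝ) ^ Fintype.card κ := by positivity
  rw [badRatio, le_sub_iff_add_le, ← le_sub_iff_add_le', div_le_iff₀ hqp]
  have h4 : (1 / 2 : ℝ) ^ Fintype.card κ * (Fintype.card F : ℝ) ^ Fintype.card κ ≤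
      ((Fintype.card F : ℝ) - 1) ^ Fintype.card κ := by
    rw [← mul_pow]
    gcongr
    linarith
  linarith

/-- Total probability: summing over the first block restores the ball in the full length. -/
theorem sum_badRatio {ι : Type*} [Fintype ι] [DecidableEq ι] (d : ℕ) :
    ∑ x : ι → F, badRatio F κ d (hammingNorm x) =
      ballSum (Fintype.card F) (Fintype.card ι + Fintype.card κ) d /
        (Fintype.card F : ℝ) ^ Fintype.card κ := by
  rw [← card_prod_hammingNorm_lt (ι := ι) (κ := κ) (F := F)]
  unfold badRatio
  rw [← Finset.sum_div]
  congr 1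
  rw [Finset.card_filter, Fintype.sum_prod_type]
  push_cast
  refine Finset.sum_congr rfl fun x _ => ?_
  rw [Finset.card_filter]
  push_cast
  rfl

/-- Extending a linear map by finitely many coordinates so that all words get weight at least `d`,
when low weight words are independent in small groups. -/
theorem exists_extension {V : Type*} [AddCommGroup V] [Module F V] [Finite V] (R : Finset V)
    (w : V → ℕ) (d T : ℕ) (μ : ℝ) (hs : 1 ≤ Fintype.card κ)
    (h1 : ∑ u ∈ R, badRatio F κ d (w u) ≤ μ)
    (h2 : ∀ u ∈ R, d ≤ w u + Fintype.card κ)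
    (h3 : ∀ S ⊆ R, (∀ u ∈ S, w u < d) → S.card ≤ T → LinearIndepOn F id (S : Set V))
    (hT : 2 * (μ ^ T / T.factorial) < Real.exp (-(2 * Fintype.card κ * μ))) :
    ∃ f : V →ₗ[F] (κ → F), ∀ u ∈ R, d ≤ w u + hammingNorm (f u) := by
  classical
  have : Finite (V →ₗ[F] (κ → F)) := Finite.of_injective (fun f => (f : V → κ → F))
    DFunLike.coe_injective
  have : Fintype (V →ₗ[F] (κ → F)) := Fintype.ofFinite _
  have hsum : ∑ u ∈ R.filter fun u => w u < d, badRatio F κ d (w u) ≤ μ :=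
    (Finset.sum_le_sum_of_subset_of_nonneg (Finset.filter_subset _ _)
      fun u _ _ => badRatio_nonneg _ _).trans h1
  have hsum0 : 0 ≤ ∑ u ∈ R.filter fun u => w u < d, badRatio F κ d (w u) :=
    Finset.sum_nonneg fun u _ => badRatio_nonneg _ _
  suffices h : ∃ f : V →ₗ[F] (κ → F), ∀ u ∈ R.filter fun u => w u < d,
      ¬ w u + hammingNorm (f u) < d by
    obtain ⟨f, hf⟩ := h
    refine ⟨f, fun u hu => ?_⟩
    by_contra! h
    exact hf u (Finset.mem_filter.2 ⟨hu, by omega⟩) h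
  refine exists_forall_not_of_independent (R.filter fun u => w u < d)
    (fun u (f : V →ₗ[F] (κ → F)) => w u + hammingNorm (f u) < d)
    (fun u => badRatio F κ d (w u)) T (fun u _ => badRatio_nonneg _ _) ?_ ?_ ?_
  · intro u hu
    have := half_pow_le_one_sub_badRatio (F := F) (h2 u (Finset.mem_filter.1 hu).1)
    have : (0 : ℝ) ≤ (1 / 2 : ℝ) ^ Fintype.card κ := by positivity
    linarith
  · intro S hS hSc
    have hli := h3 S (hS.trans (Finset.filter_subset _ _))
      (fun u hu => (Finset.mem_filter.1 (hS hu)).2) hSc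
    have h := sum_linearMap_comp_linearIndependent (W := κ → F) (σ := S)
      (v := fun u : S => (u : V)) hli
      (fun b => ∏ u : S, if w u + hammingNorm (b u) < d then 1 else 0)
    have h4 := Finset.prod_univ_sum (R := ℝ) (fun _ : S => (Finset.univ : Finset (κ → F)))
      (fun u y => if w u + hammingNorm y < d then 1 else 0)
    rw [Fintype.piFinset_univ] at h4
    rw [← h4] at h
    have h5 : ∀ u : S, ∑ y : κ → F, (if w u + hammingNorm y < d then (1 : ℝ) else 0) =
        (Fintype.card F : ℝ) ^ Fintype.card κ * badRatio F κ d (w u) := by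
      intro u
      rw [badRatio, mul_div_cancel₀ _ (by positivity), Finset.card_filter]
      push_cast
      rfl
    simp only [h5] at h
    rw [Finset.prod_mul_distrib, Finset.prod_const, Finset.card_univ, Fintype.card_fun,
      Nat.cast_pow, Finset.prod_coe_sort S fun u => badRatio F κ d (w u)] at h
    have h6 : ((Finset.univ.filter fun f : V →ₗ[F] (κ → F) =>
        ∀ u ∈ S, w u + hammingNorm (f u) < d).card : ℝ) =
        ∑ f : V →ₗ[F] (κ → F), ∏ u : S, if w u + hammingNorm (f u) < d then 1 else 0 := by
      rw [Finset.card_filter]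
      push_cast
      refine Finset.sum_congr rfl fun f _ => ?_
      rw [Finset.prod_ite_zero]
      simp
    rw [h6]
    refine mul_left_cancel₀ (b := ∑ f : V →ₗ[F] (κ → F), _)
      (a := ((Fintype.card F : ℝ) ^ Fintype.card κ) ^ Fintype.card S) (by positivity) ?_
    rw [h]
    ring
  · calc _ ≤ 2 * (μ ^ T / T.factorial) := by gcongr
      _ < _ := hT
      _ ≤ Real.exp (-(2 * Fintype.card κ *
          ∑ u ∈ R.filter fun u => w u < d, badRatio F κ d (w u))) := by
        apply Real.exp_le_exp.2
        gcongr
      _ = ∏ u ∈ R.filter fun u => w u < d,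
          Real.exp (-(2 * Fintype.card κ * badRatio F κ d (w u))) := by
        rw [← Real.exp_sum, Finset.mul_sum, Finset.sum_neg_distrib]
      _ ≤ _ := Finset.prod_le_prod (fun u _ => (Real.exp_pos _).le) fun u hu =>
        exp_neg_le_one_sub hs (badRatio_nonneg _ _)
          (half_pow_le_one_sub_badRatio (h2 u (Finset.mem_filter.1 hu).1))

end

/-! ### Linear independence and representatives of lines. -/

/-- If the vectors of `S` are nonzero and pairwise non-proportional, and no vector of `S` is a
combination with at least two terms of independent vectors of `S`, then `S` is independent. -/
theorem linearIndepOn_of_no_circuit {F V : Type*} [Field F] [AddCommGroup V] [Module F V]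
    (S : Finset V) (h0 : ∀ u ∈ S, u ≠ 0)
    (hprop : ∀ u ∈ S, ∀ v ∈ S, ∀ c : F, u = c • v → u = v)
    (hc : ∀ (m : ℕ) (v : Fin (m + 2) → V) (a : Fin (m + 2) → F), m + 2 < S.card →
      LinearIndependent F v → (∀ i, a i ≠ 0) → (∀ i, v i ∈ S) → ∑ i, a i • v i ∉ S) :
    LinearIndepOn F id (S : Set V) := by
  classical
  suffices h : ∀ S' ⊆ S, LinearIndepOn F id (S' : Set V) from h S subset_rfl
  intro S'
  induction S' using Finset.induction_on with
  | empty => intro; simp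
  | insert x S' hx ih =>
    intro hS
    have hS' : S' ⊆ S := (Finset.subset_insert _ _).trans hS
    have hxS : x ∈ S := hS (Finset.mem_insert_self _ _)
    have hli := ih hS'
    rw [Finset.coe_insert]
    refine hli.id_insert fun hspan => ?_
    obtain ⟨f, hf, hfx⟩ := Submodule.mem_span_finset.1 hspan
    -- The support of a combination giving `x`. Sizes 0 and 1 contradict `h0` and `hprop`; a larger
    -- support is an excluded relation.
    let U := S'.filter fun u => f u ≠ 0
    have hUx : ∑ u ∈ U, f u • u = x := by
      rw [← hfx]
      refine Finset.sum_subset (Finset.filter_subset _ _) fun u hu hu' => ?_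
      have : f u = 0 := by
        by_contra h
        exact hu' (Finset.mem_filter.2 ⟨hu, h⟩)
      simp [this]
    have hUS : U ⊆ S' := Finset.filter_subset _ _
    have hcard : U.card < S.card :=
      Finset.card_lt_card ⟨hUS.trans hS', fun h => hx (hUS (h hxS))⟩
    rcases Nat.lt_or_ge U.card 2 with h | h
    · interval_cases hU : U.card
      · rw [Finset.card_eq_zero.1 hU] at hUx
        exact h0 x hxS (by simpa using hUx.symm)
      · obtain ⟨u, hu⟩ := Finset.card_eq_one.1 hU
        rw [hu, Finset.sum_singleton] at hUx
        have huS' : u ∈ S' := hUS (by simp [hu])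
        have := hprop x hxS u (hS' huS') _ hUx.symm
        exact hx (this ▸ huS')
    · obtain ⟨m, hm⟩ : ∃ m, U.card = m + 2 := ⟨U.card - 2, by omega⟩
      let e : Fin (m + 2) ≃ U := (U.equivFinOfCardEq hm).symm
      refine hc m (fun i => (e i : V)) (fun i => f (e i)) (by omega) ?_
        (fun i => (Finset.mem_filter.1 (e i).2).2) (fun i => hS' (hUS (e i).2)) ?_
      · have h1 : LinearIndepOn F id (U : Set V) := hli.mono (by exact_mod_cast hUS)
        exact LinearIndependent.comp h1 e e.injective
      · have : ∑ i, f (e i) • (e i : V) = x := by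
          rw [← hUx, e.sum_comp fun u : U => f u • (u : V)]
          exact Finset.sum_coe_sort U fun u => f u • u
        rw [this]
        exact hxS

/-- One representative for every line of a vector space over a finite field. -/
theorem exists_lines_representatives (F V : Type*) [Field F] [Fintype F] [AddCommGroup V]
    [Module F V] [Finite V] :
    ∃ R : Finset V, (∀ u ∈ R, u ≠ 0) ∧ (∀ u ∈ R, ∀ v ∈ R, ∀ c : F, u = c • v → u = v) ∧
      (∀ x : V, x ≠ 0 → ∃ u ∈ R, ∃ c : F, c ≠ 0 ∧ x = c • u) ∧
      R.card * (Fintype.card F - 1) + 1 = Nat.card V := by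
  classical
  have : Fintype (Projectivization F V) := Fintype.ofFinite _
  have hinj : Function.Injective (fun p : Projectivization F V => p.rep) := fun p p' h => by
    rw [← p.mk_rep, ← p'.mk_rep]
    congr 1
  refine ⟨Finset.univ.image fun p : Projectivization F V => p.rep, ?_, ?_, ?_, ?_⟩
  · intro u hu
    obtain ⟨p, -, rfl⟩ := Finset.mem_image.1 hu
    exact p.rep_nonzero
  · intro u hu v hv c h
    obtain ⟨p, -, rfl⟩ := Finset.mem_image.1 hu
    obtain ⟨p', -, rfl⟩ := Finset.mem_image.1 hv
    congr 1
    rw [← p.mk_rep, ← p'.mk_rep, Projectivization.mk_eq_mk_iff']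
    exact ⟨c, h.symm⟩
  · intro x hx
    obtain ⟨c, hc⟩ := Projectivization.exists_smul_eq_mk_rep F x hx
    refine ⟨_, Finset.mem_image_of_mem _ (Finset.mem_univ (Projectivization.mk F x hx)),
      (c⁻¹ : Fˣ), Units.ne_zero _, ?_⟩
    rw [← hc]
    simp [Units.smul_def]
  · rw [Finset.card_image_of_injective _ hinj, Projectivization.card' F V, Finset.card_univ,
      Nat.card_eq_fintype_card, Nat.card_eq_fintype_card]

/-! ### First moments for the random map on the first block. -/

section

variable {F V ι : Type*} [Field F] [Fintype F] [DecidableEq F] [AddCommGroup V] [Module F V]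
  [Fintype ι] [DecidableEq ι]

open Classical in
/-- Linear relations with `m + 3` terms between vectors of small weight under `G`. -/
noncomputable def lowWeightRelations [Fintype V] (d m : ℕ) (G : V →ₗ[F] (ι → F)) :
    Finset ((Fin (m + 2) → V) × (Fin (m + 2) → F)) :=
  Finset.univ.filter fun p => (LinearIndependent F p.1 ∧ ∀ i, p.2 i ≠ 0) ∧
    (∀ i, hammingNorm (G (p.1 i)) < d) ∧ hammingNorm (G (∑ i, p.2 i • p.1 i)) < d

/-- For independent `p.1` the images are uniform and independent, so `card_combination_le` bounds
the probability of each relation; there are at most `(|V| q)^(m+2)` choices of vectors and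
coefficients. -/
theorem sum_card_lowWeightRelations_le [Fintype V] [Fintype (V →ₗ[F] (ι → F))] (d m N : ℕ)
    (hN : ∀ a b : F, a ≠ 0 → b ≠ 0 → ∀ z : ι → F,
      (Finset.univ.filter fun p : (ι → F) × (ι → F) => hammingNorm p.1 < d ∧
        hammingNorm p.2 < d ∧ hammingNorm (a • p.1 + (b • p.2 + z)) < d).card ≤ N) :
    ∑ G : V →ₗ[F] (ι → F), ((lowWeightRelations d m G).card : ℝ) ≤
      Fintype.card (V →ₗ[F] (ι → F)) *
        (((Fintype.card V : ℝ) * Fintype.card F / (Fintype.card F : ℝ) ^ Fintype.card ι) ^ (m + 2) *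
          (N * ballSum (Fintype.card F) (Fintype.card ι) d ^ m)) := by
  classical
  have hb0 := ballSum_nonneg (Fintype.card_pos (α := F)) (Fintype.card ι) d
  set C : ℝ := Fintype.card (V →ₗ[F] (ι → F)) *
    (N * ballSum (Fintype.card F) (Fintype.card ι) d ^ m) /
      ((Fintype.card F : ℝ) ^ Fintype.card ι) ^ (m + 2) with hC
  have hC0 : 0 ≤ C := by positivity
  have h1 : ∀ p : (Fin (m + 2) → V) × (Fin (m + 2) → F),
      ∑ G : V →ₗ[F] (ι → F), (if (LinearIndependent F p.1 ∧ ∀ i, p.2 i ≠ 0) ∧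
        (∀ i, hammingNorm (G (p.1 i)) < d) ∧ hammingNorm (G (∑ i, p.2 i • p.1 i)) < d
        then (1 : ℝ) else 0) ≤ C := by
    rintro ⟨v, a⟩
    by_cases hva : LinearIndependent F v ∧ ∀ i, a i ≠ 0
    · have h2 := sum_linearMap_comp_linearIndependent (W := ι → F) hva.1 fun b =>
        if (∀ i, hammingNorm (b i) < d) ∧ hammingNorm (∑ i, a i • b i) < d then (1 : ℝ) else 0
      have h3 := card_combination_le a (hN (a 0) (a 1) (hva.2 0) (hva.2 1))
      have h4 : (∑ b : Fin (m + 2) → ι → F,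
          if (∀ i, hammingNorm (b i) < d) ∧ hammingNorm (∑ i, a i • b i) < d then (1 : ℝ) else 0) ≤
          N * ballSum (Fintype.card F) (Fintype.card ι) d ^ m := by
        rw [← card_hammingNorm_lt]
        have h3' := (Nat.cast_le (α := ℝ)).2 h3
        rw [Finset.card_filter] at h3'
        push_cast at h3'
        exact h3'
      rw [hC, le_div_iff₀ (by positivity)]
      simp only [eq_true hva, true_and, map_sum, map_smul]
      rw [Fintype.card_fun, Fintype.card_fin, Nat.cast_pow] at h2
      rw [mul_comm]
      exact h2.trans_le (mul_le_mul_of_nonneg_left h4 (Nat.cast_nonneg _))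
    · simp only [hva, false_and, if_false, Finset.sum_const_zero]
      exact hC0
  calc _ = ∑ G : V →ₗ[F] (ι → F), ∑ p : (Fin (m + 2) → V) × (Fin (m + 2) → F),
        (if (LinearIndependent F p.1 ∧ ∀ i, p.2 i ≠ 0) ∧
        (∀ i, hammingNorm (G (p.1 i)) < d) ∧ hammingNorm (G (∑ i, p.2 i • p.1 i)) < d
        then (1 : ℝ) else 0) := by
        refine Finset.sum_congr rfl fun G _ => ?_
        rw [lowWeightRelations, Finset.card_filter]
        push_cast
        rfl
    _ ≤ ∑ p : (Fin (m + 2) → V) × (Fin (m + 2) → F), C := by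
        rw [Finset.sum_comm]
        exact Finset.sum_le_sum fun p _ => h1 p
    _ = _ := by
        rw [Finset.sum_const, Finset.card_univ, Fintype.card_prod, Fintype.card_fun,
          Fintype.card_fun, Fintype.card_fin, nsmul_eq_mul, hC]
        push_cast
        rw [div_pow, mul_pow]
        ring

theorem sum_badRatio_linearMap {κ : Type*} [Fintype κ] [DecidableEq κ]
    [Fintype (V →ₗ[F] (ι → F))] (R : Finset V) (h0 : ∀ u ∈ R, u ≠ 0) (d : ℕ) :
    ∑ G : V →ₗ[F] (ι → F), ∑ u ∈ R, badRatio F κ d (hammingNorm (G u)) =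
      Fintype.card (V →ₗ[F] (ι → F)) *
        (R.card * ballSum (Fintype.card F) (Fintype.card ι + Fintype.card κ) d /
          (Fintype.card F : ℝ) ^ (Fintype.card ι + Fintype.card κ)) := by
  rw [Finset.sum_comm]
  have hq : (0 : ℝ) < Fintype.card F := by exact_mod_cast Fintype.card_pos
  have h1 : ∀ u ∈ R, ∑ G : V →ₗ[F] (ι → F), badRatio F κ d (hammingNorm (G u)) =
      Fintype.card (V →ₗ[F] (ι → F)) *
        (ballSum (Fintype.card F) (Fintype.card ι + Fintype.card κ) d /
          (Fintype.card F : ℝ) ^ (Fintype.card ι + Fintype.card κ)) := by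
    intro u hu
    have h := sum_linearMap_apply (F := F) (W := ι → F) (h0 u hu) fun x => badRatio F κ d (hammingNorm x)
    rw [sum_badRatio, Fintype.card_fun, Nat.cast_pow] at h
    refine mul_left_cancel₀ (pow_pos hq (Fintype.card ι)).ne' (h.trans ?_)
    rw [pow_add]
    field_simp
  rw [Finset.sum_congr rfl h1, Finset.sum_const, nsmul_eq_mul]
  ring

theorem sum_card_lowWeight_linearMap [Fintype (V →ₗ[F] (ι → F))] (R : Finset V)
    (h0 : ∀ u ∈ R, u ≠ 0) (r : ℕ) :
    ∑ G : V →ₗ[F] (ι → F), ((R.filter fun u => hammingNorm (G u) < r).card : ℝ) =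
      Fintype.card (V →ₗ[F] (ι → F)) *
        (R.card * ballSum (Fintype.card F) (Fintype.card ι) r /
          (Fintype.card F : ℝ) ^ Fintype.card ι) := by
  -- With no extra coordinates, `badRatio` is the indicator of low weight.
  have h := sum_badRatio_linearMap (F := F) (κ := Fin 0) (ι := ι) R h0 r
  rw [Fintype.card_fin, add_zero] at h
  rw [← h]
  refine Finset.sum_congr rfl fun G _ => ?_
  rw [Finset.card_filter]
  push_cast
  refine Finset.sum_congr rfl fun u _ => ?_
  have hz : ∀ y : Fin 0 → F, hammingNorm y = 0 := fun y => by simp [hammingNorm]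
  by_cases hu : hammingNorm (G u) < r <;> simp [badRatio, hu, hz]

/-- The first moment method: a random linear map has no words of weight less than `d`. -/
theorem exists_linearMap_of_card_mul_lt [Finite V] (R : Finset V) (h0 : ∀ u ∈ R, u ≠ 0) (d : ℕ)
    (h : R.card * ballSum (Fintype.card F) (Fintype.card ι) d <
      (Fintype.card F : ℝ) ^ Fintype.card ι) :
    ∃ G : V →ₗ[F] (ι → F), ∀ u ∈ R, d ≤ hammingNorm (G u) := by
  classical
  have : Finite (V →ₗ[F] (ι → F)) := Finite.of_injective (fun f => (f : V → ι → F))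
    DFunLike.coe_injective
  have : Fintype (V →ₗ[F] (ι → F)) := Fintype.ofFinite _
  have hN : (0 : ℝ) < Fintype.card (V →ₗ[F] (ι → F)) := by exact_mod_cast Fintype.card_pos
  have hq : (0 : ℝ) < Fintype.card F := by exact_mod_cast Fintype.card_pos
  obtain ⟨G, -, hG⟩ := Finset.exists_lt_of_sum_lt (s := Finset.univ)
    (f := fun G : V →ₗ[F] (ι → F) => ((R.filter fun u => hammingNorm (G u) < d).card : ℝ))
    (g := fun _ => 1) (by
      rw [sum_card_lowWeight_linearMap R h0, Finset.sum_const, Finset.card_univ, nsmul_eq_mul]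
      refine mul_lt_mul_of_pos_left ?_ hN
      rwa [div_lt_one (by positivity)])
  have hG' : (R.filter fun u => hammingNorm (G u) < d).card = 0 := by
    have : (R.filter fun u => hammingNorm (G u) < d).card < 1 := by exact_mod_cast hG
    omega
  refine ⟨G, fun u hu => ?_⟩
  by_contra! hlt
  have := Finset.card_eq_zero.1 hG'
  exact Finset.notMem_empty u (this ▸ Finset.mem_filter.2 ⟨hu, hlt⟩)

/-- Three nonnegative quantities, each of mean at most 1/4, are simultaneously below 1 for some `G`
on the first block. Those that are cardinalities then vanish, which supplies the hypotheses of
`exists_extension`. -/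
theorem exists_linearMap_of_moments {κ : Type*} [Fintype V] [Fintype κ] [DecidableEq κ]
    (R : Finset V)
    (h0 : ∀ u ∈ R, u ≠ 0) (hprop : ∀ u ∈ R, ∀ v ∈ R, ∀ c : F, u = c • v → u = v)
    (d T N : ℕ) (μ : ℝ) (hμ : 0 < μ) (hs : 1 ≤ Fintype.card κ)
    (hN : ∀ a b : F, a ≠ 0 → b ≠ 0 → ∀ z : ι → F,
      (Finset.univ.filter fun p : (ι → F) × (ι → F) => hammingNorm p.1 < d ∧
        hammingNorm p.2 < d ∧ hammingNorm (a • p.1 + (b • p.2 + z)) < d).card ≤ N)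
    (hA : R.card * ballSum (Fintype.card F) (Fintype.card ι + Fintype.card κ) d /
          (Fintype.card F : ℝ) ^ (Fintype.card ι + Fintype.card κ) ≤ μ / 4)
    (hB : R.card * ballSum (Fintype.card F) (Fintype.card ι) (d - Fintype.card κ) /
          (Fintype.card F : ℝ) ^ Fintype.card ι ≤ 1 / 4)
    (hC : ∑ m ∈ Finset.range T,
      ((Fintype.card V : ℝ) * Fintype.card F / (Fintype.card F : ℝ) ^ Fintype.card ι) ^ (m + 2) *
          (N * ballSum (Fintype.card F) (Fintype.card ι) d ^ m) ≤ 1 / 4)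
    (hT : 2 * (μ ^ T / T.factorial) < Real.exp (-(2 * Fintype.card κ * μ))) :
    ∃ G : V →ₗ[F] (ι ⊕ κ → F), ∀ u ∈ R, d ≤ hammingNorm (G u) := by
  classical
  have : Finite (V →ₗ[F] (ι → F)) := Finite.of_injective (fun f => (f : V → ι → F))
    DFunLike.coe_injective
  have : Fintype (V →ₗ[F] (ι → F)) := Fintype.ofFinite _
  have hΩ : (0 : ℝ) < Fintype.card (V →ₗ[F] (ι → F)) := by exact_mod_cast Fintype.card_pos
  obtain ⟨G, -, hG⟩ := Finset.exists_lt_of_sum_lt (s := Finset.univ)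
    (f := fun G : V →ₗ[F] (ι → F) =>
      (∑ u ∈ R, badRatio F κ d (hammingNorm (G u))) / μ +
      ((R.filter fun u => hammingNorm (G u) < d - Fintype.card κ).card : ℝ) +
      ∑ m ∈ Finset.range T, ((lowWeightRelations d m G).card : ℝ))
    (g := fun _ => 1) (by
      rw [Finset.sum_add_distrib, Finset.sum_add_distrib, ← Finset.sum_div,
        sum_badRatio_linearMap R h0, sum_card_lowWeight_linearMap R h0, Finset.sum_comm,
        Finset.sum_const, Finset.card_univ, nsmul_eq_mul]
      have h3 := Finset.sum_le_sum fun m (_ : m ∈ Finset.range T) =>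
        sum_card_lowWeightRelations_le (V := V) (ι := ι) d m N hN
      rw [← Finset.mul_sum] at h3
      have h3' := h3.trans (mul_le_mul_of_nonneg_left hC hΩ.le)
      have h2 := mul_le_mul_of_nonneg_left hB hΩ.le
      have h1 := mul_le_mul_of_nonneg_left hA hΩ.le
      have h1' := div_le_div_of_nonneg_right h1 hμ.le
      have e : (Fintype.card (V →ₗ[F] (ι → F)) : ℝ) * (μ / 4) / μ =
        Fintype.card (V →ₗ[F] (ι → F)) * (1 / 4) := by field_simp
      rw [e] at h1'
      linarith)
  have p1 : 0 ≤ (∑ u ∈ R, badRatio F κ d (hammingNorm (G u))) / μ :=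
    div_nonneg (Finset.sum_nonneg fun u _ => badRatio_nonneg _ _) hμ.le
  have p2 : (0 : ℝ) ≤ ((R.filter fun u => hammingNorm (G u) < d - Fintype.card κ).card : ℝ) :=
    Nat.cast_nonneg _
  have p3 : 0 ≤ ∑ m ∈ Finset.range T, ((lowWeightRelations d m G).card : ℝ) := by positivity
  have g1 : ∑ u ∈ R, badRatio F κ d (hammingNorm (G u)) ≤ μ := by
    rw [← div_le_one hμ]
    linarith
  have g2 : (R.filter fun u => hammingNorm (G u) < d - Fintype.card κ) = ∅ := by
    have : ((R.filter fun u => hammingNorm (G u) < d - Fintype.card κ).card : ℝ) < 1 := by linarith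
    have : (R.filter fun u => hammingNorm (G u) < d - Fintype.card κ).card < 1 := by
      exact_mod_cast this
    exact Finset.card_eq_zero.1 (by omega)
  have g3 : ∀ m < T, lowWeightRelations d m G = ∅ := by
    intro m hm
    have h := Finset.single_le_sum (f := fun m => ((lowWeightRelations d m G).card : ℝ))
      (fun m _ => Nat.cast_nonneg _) (Finset.mem_range.2 hm)
    have : ((lowWeightRelations d m G).card : ℝ) < 1 := by
      refine lt_of_le_of_lt h ?_
      linarith
    have : (lowWeightRelations d m G).card < 1 := by exact_mod_cast this
    exact Finset.card_eq_zero.1 (by omega)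
  obtain ⟨f, hf⟩ := exists_extension (F := F) (κ := κ) R (fun u => hammingNorm (G u)) d T μ hs g1
    (fun u hu => by
      by_contra! h
      exact Finset.notMem_empty u (g2 ▸ Finset.mem_filter.2 ⟨hu, by omega⟩))
    (fun S hS hlow hcard => linearIndepOn_of_no_circuit S (fun u hu => h0 u (hS hu))
      (fun u hu v hv c => hprop u (hS hu) v (hS hv) c) fun m v a hm hv ha hvS haS => by
        have : (v, a) ∈ lowWeightRelations d m G := by
          unfold lowWeightRelations
          exact Finset.mem_filter.2 ⟨Finset.mem_univ _, ⟨hv, ha⟩, fun i => hlow _ (hvS i),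
            hlow _ haS⟩
        rw [g3 m (by omega)] at this
        exact Finset.notMem_empty _ this) hT
  refine ⟨{ toFun := fun u => Sum.elim (G u) (f u), map_add' := ?_, map_smul' := ?_ },
    fun u hu => ?_⟩
  · intro x y
    funext i
    cases i <;> simp
  · intro c x
    funext i
    cases i <;> simp
  · rw [LinearMap.coe_mk, AddHom.coe_mk, hammingNorm_sumElim]
    exact hf u hu

end

/-! ### From linear maps to codes of exact minimum distance; Reed–Solomon codes. -/

section

variable {F V : Type*} [Field F] [DecidableEq F] [AddCommGroup V] [Module F V]

theorem hammingNorm_update_zero {n : ℕ} (x : Fin n → F) (i : Fin n) :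
    hammingNorm (Function.update x i 0) =
      ((Finset.univ.filter fun j => x j ≠ 0).erase i).card := by
  unfold hammingNorm
  congr 1
  ext j
  by_cases h : j = i
  · subst h
    simp
  · simp [h]

/-- Zeroing a coordinate in the support of a word of minimum weight lowers the minimum weight
by one. -/
theorem exists_minWeight_pred {n e : ℕ} (G : V →ₗ[F] (Fin n → F))
    (h1 : ∀ u, u ≠ 0 → e + 1 ≤ hammingNorm (G u)) (h2 : ∃ u, u ≠ 0 ∧ hammingNorm (G u) = e + 1) :
    ∃ G' : V →ₗ[F] (Fin n → F), (∀ u, u ≠ 0 → e ≤ hammingNorm (G' u)) ∧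
      ∃ u, u ≠ 0 ∧ hammingNorm (G' u) = e := by
  obtain ⟨u, hu, hGu⟩ := h2
  obtain ⟨i, hi⟩ : ∃ i, G u i ≠ 0 := by
    by_contra! h
    have : G u = 0 := funext h
    rw [this, hammingNorm_zero] at hGu
    omega
  let G' : V →ₗ[F] (Fin n → F) :=
    (LinearMap.pi fun j => if j = i then 0 else LinearMap.proj j) ∘ₗ G
  have hG' : ∀ v, G' v = Function.update (G v) i 0 := by
    intro v
    funext j
    by_cases h : j = i
    · subst h
      simp [G']
    · simp [G', h]
  refine ⟨G', fun v hv => ?_, u, hu, ?_⟩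
  · rw [hG', hammingNorm_update_zero]
    have := Finset.pred_card_le_card_erase (s := Finset.univ.filter fun j => G v j ≠ 0) (a := i)
    have h3 := h1 v hv
    unfold hammingNorm at h3
    omega
  · rw [hG', hammingNorm_update_zero, Finset.card_erase_of_mem (by simp [hi])]
    unfold hammingNorm at hGu
    omega

/-- Start from the true minimum weight of `G` and descend to `d`, zeroing one coordinate at a time.
-/
theorem exists_minWeight_eq [Nontrivial V] {n d : ℕ} (G : V →ₗ[F] (Fin n → F))
    (h : ∀ u, u ≠ 0 → d ≤ hammingNorm (G u)) :
    ∃ G' : V →ₗ[F] (Fin n → F), (∀ u, u ≠ 0 → d ≤ hammingNorm (G' u)) ∧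
      ∃ u, u ≠ 0 ∧ hammingNorm (G' u) = d := by
  have hex : ∃ w, ∃ u, u ≠ 0 ∧ hammingNorm (G u) = w := by
    obtain ⟨u, hu⟩ := exists_ne (0 : V)
    exact ⟨_, u, hu, rfl⟩
  classical
  have hmin : ∃ e, d ≤ e ∧ ∃ G' : V →ₗ[F] (Fin n → F), (∀ u, u ≠ 0 → e ≤ hammingNorm (G' u)) ∧
      ∃ u, u ≠ 0 ∧ hammingNorm (G' u) = e := by
    refine ⟨Nat.find hex, ?_, G, fun u hu => Nat.find_min' hex ⟨u, hu, rfl⟩, Nat.find_spec hex⟩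
    obtain ⟨u, hu, hw⟩ := Nat.find_spec hex
    rw [← hw]
    exact h u hu
  obtain ⟨e, hde, he⟩ := hmin
  induction e, hde using Nat.le_induction with
  | base => exact he
  | succ e hde ih =>
    obtain ⟨G', h1, h2⟩ := he
    exact ih (exists_minWeight_pred G' h1 h2)

theorem exists_isLinearCode_of_linearMap {n k d : ℕ} (hk : 1 ≤ k) (hd : 1 ≤ d)
    (G : (Fin k → F) →ₗ[F] (Fin n → F)) (h : ∀ u, u ≠ 0 → d ≤ hammingNorm (G u)) :
    ∃ C : Submodule F (Fin n → F), IsLinearCode n k d C := by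
  have : Nonempty (Fin k) := ⟨⟨0, hk⟩⟩
  obtain ⟨G', h1, u, hu, hGu⟩ := exists_minWeight_eq G h
  have hinj : Function.Injective G' := by
    rw [injective_iff_map_eq_zero]
    intro x hx
    by_contra hne
    have := h1 x hne
    rw [hx, hammingNorm_zero] at this
    omega
  -- `codeDistances` uses classical decidable equality, so the two instances have to be reconciled.
  have hdist : ∀ x y, @hammingDist (Fin n) (fun _ => F) _ (fun _ => Classical.decEq F) x y =
      hammingNorm (x - y) := by
    intro x y
    rw [sub_eq_neg_add, ← hammingDist_eq_hammingNorm y x, hammingDist_comm y x]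
    congr!
  refine ⟨LinearMap.range G', ?_, ?_, ?_⟩
  · rw [LinearMap.finrank_range_of_inj hinj]
    simp
  · refine ⟨G' u, ⟨u, rfl⟩, 0, ⟨0, map_zero _⟩, fun h0 => hu (hinj (h0.trans (map_zero _).symm)), ?_⟩
    have := hdist (G' u) 0
    rw [sub_zero, hGu] at this
    convert this
  · rintro w ⟨x, ⟨a, rfl⟩, y, ⟨b, rfl⟩, hne, hw⟩
    have h2 := h1 (a - b) (sub_ne_zero.2 fun hab => hne (by rw [hab]))
    have := hdist (G' a) (G' b)
    rw [← map_sub] at this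
    rw [← hw]
    convert h2.trans this.ge

/-- Reed–Solomon codes. -/
theorem exists_reedSolomon [Fintype F] {n k d : ℕ} (hn : n ≤ Fintype.card F)
    (hkd : k + d ≤ n + 1) :
    ∃ G : (Fin k → F) →ₗ[F] (Fin n → F), ∀ u, u ≠ 0 → d ≤ hammingNorm (G u) := by
  obtain ⟨x⟩ := Function.Embedding.nonempty_of_card_le (α := Fin n) (β := F) (by simpa using hn)
  let G : (Fin k → F) →ₗ[F] (Fin n → F) :=
    (LinearMap.pi fun j => Polynomial.leval (x j)) ∘ₗ (Polynomial.degreeLT F k).subtype ∘ₗ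
      (Polynomial.degreeLTEquiv F k).symm.toLinearMap
  refine ⟨G, fun u hu => ?_⟩
  set p : Polynomial F := ((Polynomial.degreeLTEquiv F k).symm u).1 with hp
  have hp0 : p ≠ 0 := by
    intro h
    apply hu
    have : (Polynomial.degreeLTEquiv F k).symm u = 0 := Subtype.ext h
    simpa using this
  have hpdeg : p.natDegree < k := by
    have h1 := Polynomial.mem_degreeLT.1 ((Polynomial.degreeLTEquiv F k).symm u).2
    exact (Polynomial.natDegree_lt_iff_degree_lt hp0).2 h1
  have hG : ∀ j, G u j = p.eval (x j) := fun j => rfl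
  have hz : (Finset.univ.filter fun j => G u j = 0).card ≤ p.natDegree := by
    rw [← Finset.card_map x]
    refine (Finset.card_le_card (t := p.roots.toFinset) ?_).trans
      ((Multiset.toFinset_card_le _).trans p.card_roots')
    intro y hy
    obtain ⟨j, hj, rfl⟩ := Finset.mem_map.1 hy
    have := (Finset.mem_filter.1 hj).2
    rw [hG] at this
    simp [hp0, this]
  have hsum := Finset.card_filter_add_card_filter_not (s := (Finset.univ : Finset (Fin n))) fun j => G u j = 0
  rw [Finset.card_univ, Fintype.card_fin] at hsum
  unfold hammingNorm
  simp only [ne_eq]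
  omega

end

/-! ### Asymptotics and constants uniform in the field size. -/

open Filter in
/-- A subexponential function is beaten by an exponential one. -/
theorem exists_forall_mul_pow_mul_pow_le (K : ℕ) {ρ : ℝ} (hρ0 : 0 < ρ) (hρ1 : ρ < 1) :
    ∃ n₀ : ℕ, ∀ n ≥ n₀, ∀ s T : ℕ, s = K * (Nat.log 2 n + 1) → T = 2 * s * (Nat.sqrt n + 1) →
      s ≤ n ∧ (T : ℝ) * ((n : ℝ) ^ ((s + 3) * (T + 1) + 8) * ρ ^ (n - s)) ≤ 1 / 4 := by
  set γ := -Real.log ρ with hγ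
  have hγ0 : 0 < γ := by
    have := Real.log_neg hρ0 hρ1
    linarith
  set C : ℝ := (3 * K + 3) * (12 * K + 1) + 8 with hC
  have hK0 : (0 : ℝ) ≤ K := Nat.cast_nonneg K
  have hC0 : 0 ≤ C := by positivity
  have e1 : ∀ᶠ n : ℕ in atTop, Real.log n ≤ (n : ℝ) ^ (1 / 8 : ℝ) := by
    have h := (isLittleO_log_rpow_atTop (show (0 : ℝ) < 1 / 8 by norm_num)).bound one_pos
    filter_upwards [tendsto_natCast_atTop_atTop.eventually h] with n hn
    rw [one_mul, Real.norm_eq_abs, Real.norm_eq_abs] at hn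
    exact (le_abs_self _).trans (hn.trans (abs_of_nonneg (by positivity)).le)
  have e2 : ∀ᶠ n : ℕ in atTop,
      1 + 6 * K + 2 * (12 * K + C + 2) / γ ≤ (n : ℝ) ^ (1 / 8 : ℝ) :=
    ((tendsto_rpow_atTop (show (0 : ℝ) < 1 / 8 by norm_num)).comp
      tendsto_natCast_atTop_atTop).eventually_ge_atTop _
  obtain ⟨n₀, hn₀⟩ := eventually_atTop.1 (e1.and (e2.and (eventually_ge_atTop 1)))
  refine ⟨n₀, fun n hn s T hs hT => ?_⟩
  obtain ⟨hlog, hx, hn1⟩ := hn₀ n hn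
  -- In powers of `x = n^(1/8)`, once `log n ≤ x`: `s` is `O(x)`, `T` is `O(x^5)`, and the logarithm
  -- of the polynomial loss is `O(x^7)`, against a gain of order `x^8`.
  set x : ℝ := (n : ℝ) ^ (1 / 8 : ℝ) with hxdef
  have hn1' : (1 : ℝ) ≤ n := by exact_mod_cast hn1
  have hnx : (n : ℝ) = x ^ 8 := by
    rw [hxdef, ← Real.rpow_natCast, ← Real.rpow_mul (by positivity)]
    norm_num
  have hd0 : 0 ≤ 2 * (12 * K + C + 2) / γ := by positivity
  have hx1 : 1 ≤ x := by linarith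
  have hx0 : 0 < x := by linarith
  have hlog0 : 0 ≤ Real.log n := Real.log_nonneg hn1'
  have hL : (Nat.log 2 n : ℝ) ≤ 2 * x := by
    have h1 : ((2 : ℕ) : ℝ) ^ Nat.log 2 n ≤ n := by
      exact_mod_cast Nat.pow_log_le_self 2 (by omega)
    have h2 := Real.log_le_log (by positivity) h1
    rw [Real.log_pow] at h2
    have h3 : (1 / 2 : ℝ) ≤ Real.log (2 : ℕ) := by
      have := Real.log_two_gt_d9
      norm_num at this ⊢
      linarith
    have h4 := mul_le_mul_of_nonneg_left h3 (Nat.cast_nonneg (α := ℝ) (Nat.log 2 n))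
    have h5 := h4.trans h2
    linarith
  have hs' : (s : ℝ) ≤ 3 * K * x := by
    rw [hs]
    push_cast
    calc (K : ℝ) * (Nat.log 2 n + 1) ≤ K * (2 * x + x) := by gcongr
      _ = _ := by ring
  have hsqrt : (Nat.sqrt n : ℝ) ≤ x ^ 4 := by
    have h1 : ((Nat.sqrt n : ℕ) : ℝ) ^ 2 ≤ (x ^ 4) ^ 2 := by
      rw [← pow_mul, ← hnx]
      exact_mod_cast Nat.sqrt_le' n
    exact le_of_sq_le_sq h1 (by positivity)
  have hx4 : 1 ≤ x ^ 4 := one_le_pow₀ hx1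
  have hT' : (T : ℝ) ≤ 12 * K * x ^ 5 := by
    rw [hT]
    push_cast
    calc (2 : ℝ) * s * (Nat.sqrt n + 1) ≤ 2 * (3 * K * x) * (x ^ 4 + x ^ 4) := by gcongr
      _ = _ := by ring
  have h2s : 2 * (s : ℝ) ≤ n := by
    calc 2 * (s : ℝ) ≤ (6 * K) * x := by linarith
      _ ≤ x * x := by gcongr; linarith
      _ = x ^ 2 := by ring
      _ ≤ x ^ 8 := pow_le_pow_right₀ hx1 (by norm_num)
      _ = n := hnx.symm
  have hsn : s ≤ n := by
    have : (s : ℝ) ≤ n := by linarith [Nat.cast_nonneg (α := ℝ) s]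
    exact_mod_cast this
  refine ⟨hsn, ?_⟩
  have hE : (((s + 3) * (T + 1) + 8 : ℕ) : ℝ) ≤ C * x ^ 6 := by
    push_cast
    have hx5 : 1 ≤ x ^ 5 := one_le_pow₀ hx1
    have hx6 : 1 ≤ x ^ 6 := one_le_pow₀ hx1
    calc ((s : ℝ) + 3) * (T + 1) + 8 ≤
        (3 * K * x + 3 * x) * (12 * K * x ^ 5 + x ^ 5) + 8 * x ^ 6 := by
          gcongr <;> linarith
      _ = _ := by rw [hC]; ring
  have f1 : (T : ℝ) ≤ Real.exp (12 * K * x ^ 7) := by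
    have := Real.add_one_le_exp (T : ℝ)
    have h2 : (T : ℝ) ≤ 12 * K * x ^ 7 := hT'.trans (by gcongr; norm_num)
    have := Real.exp_le_exp.2 h2
    linarith
  have f2 : (n : ℝ) ^ ((s + 3) * (T + 1) + 8) ≤ Real.exp (C * x ^ 7) := by
    have h1 : (n : ℝ) ^ ((s + 3) * (T + 1) + 8) =
        Real.exp (((s + 3) * (T + 1) + 8 : ℕ) * Real.log n) := by
      rw [Real.exp_nat_mul, Real.exp_log (by linarith)]
    rw [h1]
    apply Real.exp_le_exp.2
    calc _ ≤ (C * x ^ 6) * x := by gcongr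
      _ = _ := by ring
  have f3 : ρ ^ (n - s) ≤ Real.exp (-(γ * x ^ 8 / 2)) := by
    have h1 : ρ ^ (n - s) = Real.exp ((n - s : ℕ) * Real.log ρ) := by
      rw [Real.exp_nat_mul, Real.exp_log hρ0]
    rw [h1]
    apply Real.exp_le_exp.2
    rw [Nat.cast_sub hsn, ← hnx, show Real.log ρ = -γ by rw [hγ]; ring]
    nlinarith
  have f4 : Real.exp (-2) ≤ 1 / 4 := by
    have h1 : (4 : ℝ) ≤ Real.exp 2 := by
      have h2 : Real.exp 2 = Real.exp 1 * Real.exp 1 := by rw [← Real.exp_add]; norm_num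
      have := Real.add_one_le_exp (1 : ℝ)
      rw [h2]
      nlinarith
    rw [Real.exp_neg, one_div]
    gcongr
  calc _ ≤ Real.exp (12 * K * x ^ 7) * (Real.exp (C * x ^ 7) * Real.exp (-(γ * x ^ 8 / 2))) := by
        gcongr
    _ = Real.exp (12 * K * x ^ 7 + (C * x ^ 7 + -(γ * x ^ 8 / 2))) := by
        rw [Real.exp_add, Real.exp_add]
    _ ≤ Real.exp (-2) := by
        apply Real.exp_le_exp.2
        have h1 : 2 * (12 * K + C + 2) ≤ γ * x := by
          have : 2 * (12 * K + C + 2) / γ ≤ x := by linarith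
          rw [div_le_iff₀ hγ0] at this
          linarith
        have h2 : 1 ≤ x ^ 7 := one_le_pow₀ hx1
        have h3 := mul_le_mul_of_nonneg_right h1 (show 0 ≤ x ^ 7 by positivity)
        have h4 : γ * x * x ^ 7 = γ * x ^ 8 := by ring
        nlinarith
    _ ≤ _ := f4

/-- Bounding one term of the series of `exp(e² μ)` gives `μ^T / T! ≤ exp(8μ - 2T)`, and `s ≥ 5`
leaves room for the `8μ` and the factor 2. -/
theorem two_mul_pow_div_factorial_lt {μ : ℝ} {s T : ℕ} (hμ : 1 ≤ μ) (hs : 5 ≤ s)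
    (hT : 2 * s * μ ≤ T) :
    2 * (μ ^ T / T.factorial) < Real.exp (-(2 * s * μ)) := by
  have hs' : (5 : ℝ) ≤ s := by exact_mod_cast hs
  have h8 : Real.exp 2 ≤ 8 := by
    have h2 : Real.exp 2 = Real.exp 1 * Real.exp 1 := by rw [← Real.exp_add]; norm_num
    have := Real.exp_one_lt_d9
    have := Real.exp_pos 1
    rw [h2]
    nlinarith
  have h1 := Real.pow_div_factorial_le_exp (Real.exp 2 * μ) (by positivity) T
  have h2 : μ ^ T / T.factorial = Real.exp (-(2 * T)) * ((Real.exp 2 * μ) ^ T / T.factorial) := by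
    rw [mul_pow, ← Real.exp_nat_mul, mul_comm (T : ℝ) 2, mul_div_assoc, ← mul_assoc, ← Real.exp_add]
    simp
  have h3 : (2 : ℝ) ≤ Real.exp 1 := by linarith [Real.add_one_le_exp (1 : ℝ)]
  rw [h2]
  calc _ ≤ Real.exp 1 * (Real.exp (-(2 * T)) * Real.exp (8 * μ)) := by
        gcongr
        refine h1.trans ?_
        gcongr
    _ = Real.exp (1 + (-(2 * T) + 8 * μ)) := by rw [Real.exp_add, Real.exp_add]
    _ < _ := by
        apply Real.exp_lt_exp.2
        nlinarith

/-- Constants that are uniform in all field sizes `q` with `δ < 1 - 1 / q`. -/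
theorem exists_uniform_constants {δ : ℝ} (hδ0 : 0 < δ) (hδ1 : δ < 1) :
    ∃ (K : ℕ) (ρ : ℝ), 5 ≤ K ∧ 0 < ρ ∧ ρ < 1 ∧ ∀ q : ℕ, 2 ≤ q → δ < 1 - 1 / (q : ℝ) →
      (δ * q / (q - 1)) ^ K ≤ 1 / 2 ∧
      ∃ t : ℝ, 0 < t ∧ t ≤ 1 ∧ t ^ 2 * ((q : ℝ) - 1) * (1 - δ) = δ ∧
        1 - (1 - t) ^ 2 * (δ * (1 - δ)) ≤ ρ := by
  have h1δ : 0 < 1 - δ := by linarith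
  -- The least integer above `1/(1 - δ)`, hence a lower bound for every admissible `q`. Both `θ` and
  -- `β` are values at `q = p`, the worst case.
  obtain ⟨p, hp⟩ : ∃ p : ℕ, p = ⌊1 / (1 - δ)⌋₊ + 1 := ⟨_, rfl⟩
  have hp1 : 1 < p * (1 - δ) := by
    have := Nat.lt_floor_add_one (1 / (1 - δ))
    rw [div_lt_iff₀ h1δ] at this
    rw [hp]
    push_cast
    exact this
  have hpos : (1 : ℝ) < p := by
    have : (0 : ℝ) ≤ p := Nat.cast_nonneg p
    nlinarith
  have hqp : ∀ q : ℕ, 2 ≤ q → δ < 1 - 1 / (q : ℝ) → (p : ℝ) ≤ q := by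
    intro q hq h
    have hq' : (0 : ℝ) < q := by
      have : 0 < q := by omega
      exact_mod_cast this
    have h2 : 1 / (1 - δ) < q := by
      rw [div_lt_iff₀ h1δ]
      have : 1 / (q : ℝ) < 1 - δ := by linarith
      rw [div_lt_iff₀ hq'] at this
      linarith
    have := (Nat.floor_lt (by positivity)).2 h2
    exact_mod_cast (show p ≤ q by omega)
  set θ : ℝ := δ * p / (p - 1) with hθ
  have hθ0 : 0 < θ := div_pos (by positivity) (by linarith)
  have hθ1 : θ < 1 := by
    rw [hθ, div_lt_one (by linarith)]
    linarith
  set β : ℝ := δ / ((1 - δ) * (p - 1)) with hβ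
  have hβ0 : 0 < β := div_pos hδ0 (mul_pos h1δ (by linarith))
  have hβ1 : β < 1 := by
    rw [hβ, div_lt_one (mul_pos h1δ (by linarith))]
    linarith
  obtain ⟨K, hK⟩ := exists_pow_lt_of_lt_one (show (0 : ℝ) < 1 / 2 by norm_num) hθ1
  have hsβ1 : √β < 1 := by
    rw [Real.sqrt_lt' one_pos]
    linarith
  have hsβ0 : 0 ≤ √β := Real.sqrt_nonneg β
  have hδδ : 0 < δ * (1 - δ) := mul_pos hδ0 h1δ
  -- The added 5 guarantees `s ≥ 5` later; `ρ` comes from the largest possible `t`, namely `√β`.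
  refine ⟨K + 5, 1 - (1 - √β) ^ 2 * (δ * (1 - δ)), by omega, ?_, ?_, ?_⟩
  · have h1 : (1 - √β) ^ 2 ≤ 1 := by nlinarith
    have h2 : δ * (1 - δ) < 1 := by nlinarith
    nlinarith
  · have h1 : 0 < (1 - √β) ^ 2 := by
      have : 0 < 1 - √β := by linarith
      positivity
    nlinarith
  · intro q hq hδq
    have hpq := hqp q hq hδq
    refine ⟨?_, ?_⟩
    · have h1 : δ * q / (q - 1) ≤ θ := by
        rw [hθ, div_le_div_iff₀ (by linarith) (by linarith)]
        nlinarith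
      have h0 : 0 ≤ δ * q / ((q : ℝ) - 1) := div_nonneg (by positivity) (by linarith)
      calc _ ≤ θ ^ (K + 5) := by gcongr
        _ ≤ θ ^ K := pow_le_pow_of_le_one hθ0.le hθ1.le (by omega)
        _ ≤ _ := hK.le
    · have hb0 : 0 < δ / ((1 - δ) * (q - 1)) := div_pos hδ0 (mul_pos h1δ (by linarith))
      have hle : √(δ / ((1 - δ) * (q - 1))) ≤ √β := by
        apply Real.sqrt_le_sqrt
        rw [hβ]
        have : 0 < (1 - δ) * ((p : ℝ) - 1) := mul_pos h1δ (by linarith)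
        gcongr
      refine ⟨√(δ / ((1 - δ) * (q - 1))), Real.sqrt_pos.2 hb0, by linarith, ?_, ?_⟩
      · have : (q : ℝ) - 1 ≠ 0 := by linarith
        rw [Real.sq_sqrt hb0.le]
        field_simp
      · have : (1 - √β) ^ 2 ≤ (1 - √(δ / ((1 - δ) * (q - 1)))) ^ 2 := by
          have : 0 ≤ 1 - √β := by linarith
          gcongr
        nlinarith

/-! ### Fields with at most `n` elements. -/

theorem hammingNorm_comp_equiv {ι κ F : Type*} [Fintype ι] [Fintype κ] [Zero F] [DecidableEq F]
    (e : ι ≃ κ) (x : κ → F) : hammingNorm (fun i => x (e i)) = hammingNorm x := by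
  unfold hammingNorm
  exact Finset.card_equiv e fun i => by simp

/-- The choice of `t` makes `1 + (q-1)t² = 1/(1-δ) = A`, and `pow_le_ballSum` bounds `A^n` by
`t^(2d)` times the ball, up to polynomial factors. Squaring cancels the `t^(4d)` of the moment bound
and leaves only the saving `ρ`. -/
theorem card_pair_le {ι F : Type*} [Fintype ι] [DecidableEq ι] [Field F] [Fintype F]
    [DecidableEq F] {a b : F} (ha : a ≠ 0) (hb : b ≠ 0) (z : ι → F) {n d : ℕ} {δ t ρ : ℝ}
    (hδ0 : 0 < δ) (hδ1 : δ < 1) (hd0 : 1 ≤ d) (hδ : (d : ℝ) = δ * n) (ht0 : 0 < t) (ht1 : t ≤ 1)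
    (ht : t ^ 2 * ((Fintype.card F : ℝ) - 1) * (1 - δ) = δ)
    (hρ : 1 - (1 - t) ^ 2 * (δ * (1 - δ)) ≤ ρ) (hι : Fintype.card ι ≤ n) :
    ((Finset.univ.filter fun p : (ι → F) × (ι → F) => hammingNorm p.1 < d ∧
        hammingNorm p.2 < d ∧ hammingNorm (a • p.1 + (b • p.2 + z)) < d).card : ℝ) ≤
      (((n : ℝ) + 1) * n * Fintype.card F) ^ 2 * ballSum (Fintype.card F) n d ^ 2 *
        ρ ^ Fintype.card ι := by
  have h1 := card_pair_mul_pow_le ha hb z ht0 ht1 d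
  have h2 := pow_le_ballSum (q := Fintype.card F) Fintype.one_lt_card hδ0 hδ1 hd0 hδ ht
  have h1δ : 0 < 1 - δ := by linarith
  have eA : 1 + ((Fintype.card F : ℝ) - 1) * t ^ 2 = 1 / (1 - δ) := by
    rw [eq_div_iff h1δ.ne']
    linear_combination ht
  have eA' : ((Fintype.card F : ℝ) - 1) * t ^ 2 = 1 / (1 - δ) - 1 := by linarith
  rw [eA, eA'] at h1
  set A : ℝ := 1 / (1 - δ) with hA
  have hA1 : 1 ≤ A := by
    rw [hA, le_div_iff₀ h1δ]
    linarith
  have hbase : A ^ 2 - (1 - t) ^ 2 * (A - 1) = A ^ 2 * (1 - (1 - t) ^ 2 * (δ * (1 - δ))) := by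
    rw [hA]
    field_simp
    ring
  have hnn : 0 ≤ 1 - (1 - t) ^ 2 * (δ * (1 - δ)) := by
    have : (1 - t) ^ 2 ≤ 1 := by nlinarith
    have : δ * (1 - δ) ≤ 1 := by nlinarith
    have : 0 ≤ δ * (1 - δ) := by positivity
    nlinarith [sq_nonneg (1 - t)]
  have hρ0 : 0 ≤ ρ := hnn.trans hρ
  rw [hbase] at h1
  have htp : 0 < t ^ (4 * d) := by positivity
  refine le_of_mul_le_mul_right (h1.trans ?_) htp
  calc (A ^ 2 * (1 - (1 - t) ^ 2 * (δ * (1 - δ)))) ^ Fintype.card ι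
      ≤ (A ^ 2 * ρ) ^ Fintype.card ι := by gcongr
    _ = (A ^ Fintype.card ι) ^ 2 * ρ ^ Fintype.card ι := by rw [mul_pow, pow_right_comm]
    _ ≤ (A ^ n) ^ 2 * ρ ^ Fintype.card ι := by gcongr
    _ ≤ ((n + 1) * n * Fintype.card F * ballSum (Fintype.card F) n d * t ^ (2 * d)) ^ 2 *
        ρ ^ Fintype.card ι := by gcongr
    _ = _ := by
      rw [show 4 * d = 2 * d * 2 by ring, pow_mul t (2 * d) 2]
      ring

/-- After deleting `s` coordinates, where `s` is logarithmic in `n`, few words have a weight that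
cannot be repaired. -/
theorem mul_ballSum_sub_div_le {q n d s : ℕ} {δ M : ℝ} (hq2 : 2 ≤ q) (hn1 : (1 : ℝ) ≤ n)
    (hδ0 : 0 < δ) (hδ1 : δ < 1) (hdn : (d : ℝ) = δ * n) (hsn : s ≤ n)
    (hlam : M * ballSum q n d / (q : ℝ) ^ n ≤ √n / 4) (hM : 0 ≤ M)
    (h3 : (δ * q / ((q : ℝ) - 1)) ^ s ≤ 1 / n) :
    M * ballSum q (n - s) (d - s) / (q : ℝ) ^ (n - s) ≤ 1 / 4 := by
  have hq2' : (2 : ℝ) ≤ q := by exact_mod_cast hq2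
  have hq0 : (0 : ℝ) < q := by linarith
  have hB0 := ballSum_nonneg (q := q) (by omega) n d
  set B := ballSum q n d with hB
  have hsqrtn : √(n : ℝ) ≤ n := by
    rw [Real.sqrt_le_left (by linarith)]
    nlinarith
  have hsplit : (q : ℝ) ^ n = q ^ (n - s) * q ^ s := by
    rw [← pow_add, Nat.sub_add_cancel hsn]
  rcases le_total d s with hds | hds
  · rw [Nat.sub_eq_zero_of_le hds]
    simp [ballSum]
  · have h1 := ballSum_sub_le (q := q) (by omega) hδ0.le hδ1.le (n - s) (d - s) s (by
      rw [← Nat.cast_add, ← Nat.cast_add, Nat.sub_add_cancel hds, Nat.sub_add_cancel hsn, hdn])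
    rw [Nat.sub_add_cancel hds, Nat.sub_add_cancel hsn] at h1
    have hq1 : 0 < (q : ℝ) - 1 := by linarith
    have h2 : ballSum q (n - s) (d - s) ≤ (δ / (q - 1)) ^ s * B := by
      rw [div_pow, div_mul_eq_mul_div, le_div_iff₀ (by positivity)]
      linarith
    calc M * ballSum q (n - s) (d - s) / (q : ℝ) ^ (n - s)
        ≤ M * ((δ / (q - 1)) ^ s * B) / (q : ℝ) ^ (n - s) := by gcongr
      _ = M * B / (q : ℝ) ^ n * (δ * q / ((q : ℝ) - 1)) ^ s := by
        rw [hsplit, div_pow, div_pow, mul_pow]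
        field_simp
      _ ≤ √n / 4 * (1 / n) := by gcongr
      _ ≤ n / 4 * (1 / n) := by gcongr
      _ = 1 / 4 := by field_simp

/-- Each further vector of a relation costs a factor `Y * B`, at most `n^(s+3)` since `q ≤ n` and λ
is at most `√n / 4`; the factor `ρ^(n-s)` from the pair count enters once per relation. -/
theorem sum_relations_le {q n d s k : ℕ} {ρ M : ℝ} (hq2 : 2 ≤ q) (hqn' : (q : ℝ) ≤ n)
    (hsn : s ≤ n) (hlam : M * ballSum q n d / (q : ℝ) ^ n ≤ √n / 4) (hM : 0 ≤ M)
    (hqk : (q : ℝ) ^ k ≤ q * M) (hρ0 : 0 ≤ ρ) (T : ℕ) :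
    ∑ m ∈ Finset.range T, ((q : ℝ) ^ k * q / (q : ℝ) ^ (n - s)) ^ (m + 2) *
        ((⌊(((n : ℝ) + 1) * n * q) ^ 2 * ballSum q n d ^ 2 * ρ ^ (n - s)⌋₊ : ℝ) *
          ballSum q (n - s) d ^ m) ≤
      T * ((n : ℝ) ^ ((s + 3) * (T + 1) + 8) * ρ ^ (n - s)) := by
  have hq2' : (2 : ℝ) ≤ q := by exact_mod_cast hq2
  have hq0 : (0 : ℝ) < q := by linarith
  have hn1 : (1 : ℝ) ≤ n := by linarith
  have hB0 := ballSum_nonneg (q := q) (by omega) n d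
  set B := ballSum q n d with hB
  have hsqrtn : √(n : ℝ) ≤ n := by
    rw [Real.sqrt_le_left (by linarith)]
    nlinarith
  have hsplit : (q : ℝ) ^ n = q ^ (n - s) * q ^ s := by
    rw [← pow_add, Nat.sub_add_cancel hsn]
  set Y : ℝ := (q : ℝ) ^ k * q / (q : ℝ) ^ (n - s) with hY
  have hY0 : 0 ≤ Y := by positivity
  have hYB : Y * B ≤ (n : ℝ) ^ (s + 3) := by
    calc Y * B ≤ (q * M) * q / (q : ℝ) ^ (n - s) * B := by
          rw [hY]
          gcongr
      _ = (q : ℝ) ^ (s + 2) * (M * B / (q : ℝ) ^ n) := by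
        rw [hsplit, pow_add]
        field_simp
      _ ≤ (n : ℝ) ^ (s + 2) * n := by
        gcongr
        linarith
      _ = _ := by ring
  have hX : (((n : ℝ) + 1) * n * q) ^ 2 ≤ (n : ℝ) ^ 8 := by
    have h2n : (2 : ℝ) ≤ n := by linarith
    have : ((n : ℝ) + 1) * n * q ≤ n ^ 4 := by
      calc ((n : ℝ) + 1) * n * q ≤ (n * n) * n * n := by
            gcongr
            nlinarith
        _ = _ := by ring
    calc _ ≤ ((n : ℝ) ^ 4) ^ 2 := by gcongr
      _ = _ := by ring
  have hterm : ∀ m ∈ Finset.range T, Y ^ (m + 2) *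
      ((⌊(((n : ℝ) + 1) * n * q) ^ 2 * B ^ 2 * ρ ^ (n - s)⌋₊ : ℝ) *
        ballSum q (n - s) d ^ m) ≤
      (n : ℝ) ^ ((s + 3) * (T + 1) + 8) * ρ ^ (n - s) := by
    intro m hm
    have hm' := Finset.mem_range.1 hm
    have hfl := Nat.floor_le (show 0 ≤ (((n : ℝ) + 1) * n * q) ^ 2 * B ^ 2 * ρ ^ (n - s) by
      positivity)
    have hb0 := ballSum_nonneg (q := q) (by omega) (n - s) d
    calc _ ≤ Y ^ (m + 2) *
          (((((n : ℝ) + 1) * n * q) ^ 2 * B ^ 2 * ρ ^ (n - s)) * B ^ m) := by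
          gcongr
          exact ballSum_mono (by omega) (Nat.sub_le _ _) d
      _ = (Y * B) ^ (m + 2) * (((n : ℝ) + 1) * n * q) ^ 2 * ρ ^ (n - s) := by ring
      _ ≤ ((n : ℝ) ^ (s + 3)) ^ (m + 2) * (n : ℝ) ^ 8 * ρ ^ (n - s) := by gcongr
      _ ≤ ((n : ℝ) ^ (s + 3)) ^ (T + 1) * (n : ℝ) ^ 8 * ρ ^ (n - s) := by
        have : (1 : ℝ) ≤ (n : ℝ) ^ (s + 3) := one_le_pow₀ hn1
        exact mul_le_mul_of_nonneg_right (mul_le_mul_of_nonneg_right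
          (pow_le_pow_right₀ this (by omega)) (by positivity)) (by positivity)
      _ = _ := by rw [← pow_mul, pow_add]
  refine (Finset.sum_le_sum hterm).trans ?_
  rw [Finset.sum_const, Finset.card_range, nsmul_eq_mul]

/-- A linear map of minimum weight `d` exists when the field is not larger than the length
and the expected number of low weight words is at most of order `√n`. -/
theorem exists_linearMap_of_card_le_sqrt {δ : ℝ} (hδ0 : 0 < δ) (hδ1 : δ < 1) :
    ∃ n₀ : ℕ, ∀ n ≥ n₀, ∀ (F : Type*) [Field F] [Fintype F] [DecidableEq F],
      δ < 1 - 1 / (Fintype.card F : ℝ) → Fintype.card F ≤ n → ∀ k d : ℕ, 1 ≤ d →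
      (d : ℝ) = δ * n → ∀ R : Finset (Fin k → F), (∀ u ∈ R, u ≠ 0) →
      (∀ u ∈ R, ∀ v ∈ R, ∀ c : F, u = c • v → u = v) → 1 ≤ R.card →
      R.card * (Fintype.card F - 1) + 1 = Fintype.card F ^ k →
      R.card * ballSum (Fintype.card F) n d / (Fintype.card F : ℝ) ^ n ≤ √n / 4 →
      ∃ G : (Fin k → F) →ₗ[F] (Fin n → F), ∀ u ∈ R, d ≤ hammingNorm (G u) := by
  obtain ⟨K, ρ, hK, hρ0, hρ1, hconst⟩ := exists_uniform_constants hδ0 hδ1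
  obtain ⟨n₀, hn₀⟩ := exists_forall_mul_pow_mul_pow_le K hρ0 hρ1
  refine ⟨n₀, fun n hn F _ _ _ hδF hqn k d hd hdn R h0 hprop hR1 hR hlam => ?_⟩
  obtain ⟨s, hs⟩ : ∃ s, s = K * (Nat.log 2 n + 1) := ⟨_, rfl⟩
  obtain ⟨T, hT⟩ : ∃ T, T = 2 * s * (Nat.sqrt n + 1) := ⟨_, rfl⟩
  obtain ⟨hsn, hfin⟩ := hn₀ n hn s T hs hT
  have hq2 : 2 ≤ Fintype.card F := Fintype.one_lt_card
  obtain ⟨hθ, t, ht0, ht1, ht, hρ⟩ := hconst (Fintype.card F) hq2 hδF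
  set q := Fintype.card F with hq
  have hn1 : (1 : ℝ) ≤ n := by exact_mod_cast (by omega : 1 ≤ n)
  have hq2' : (2 : ℝ) ≤ q := by exact_mod_cast hq2
  have hqn' : (q : ℝ) ≤ n := by exact_mod_cast hqn
  have hq0 : (0 : ℝ) < q := by linarith
  have hs5 : 5 ≤ s := by
    rw [hs]
    nlinarith [Nat.zero_le (Nat.log 2 n)]
  set B := ballSum q n d with hB
  have hsqrt1 : 1 ≤ √(n : ℝ) := Real.one_le_sqrt.2 hn1
  -- The base raised to `K` is at most 1/2, and `s` is `K` times more than `log₂ n`.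
  have hlogs : (δ * q / ((q : ℝ) - 1)) ^ s ≤ 1 / n := by
    rw [hs, pow_mul]
    have hlt : n < 2 ^ (Nat.log 2 n + 1) := Nat.lt_pow_succ_log_self (by norm_num) n
    have hlt' : (n : ℝ) ≤ 2 ^ (Nat.log 2 n + 1) := by exact_mod_cast hlt.le
    calc _ ≤ (1 / 2 : ℝ) ^ (Nat.log 2 n + 1) := by
          gcongr
          exact pow_nonneg (div_nonneg (by positivity) (by linarith)) _
      _ = 1 / 2 ^ (Nat.log 2 n + 1) := by rw [one_div_pow]
      _ ≤ _ := by gcongr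
  have hmain := exists_linearMap_of_moments (F := F) (ι := Fin (n - s)) (κ := Fin s) R h0 hprop d T
    ⌊(((n : ℝ) + 1) * n * q) ^ 2 * B ^ 2 * ρ ^ (n - s)⌋₊ √n (by linarith)
    (by rw [Fintype.card_fin]; omega) ?_ ?_ ?_ ?_ ?_
  · obtain ⟨G, hG⟩ := hmain
    let e : Fin n ≃ Fin (n - s) ⊕ Fin s :=
      ((finSumFinEquiv (m := n - s) (n := s)).trans (finCongr (Nat.sub_add_cancel hsn))).symm
    refine ⟨LinearMap.funLeft F F e ∘ₗ G, fun u hu => (hG u hu).trans (le_of_eq ?_)⟩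
    exact (hammingNorm_comp_equiv e (G u)).symm
  · intro a b ha hb z
    refine Nat.le_floor ?_
    have := card_pair_le ha hb z hδ0 hδ1 hd hdn ht0 ht1 ht hρ
      (by rw [Fintype.card_fin]; exact Nat.sub_le _ _)
    rwa [Fintype.card_fin] at this
  · rw [Fintype.card_fin, Fintype.card_fin, Nat.sub_add_cancel hsn]
    exact hlam
  · rw [Fintype.card_fin, Fintype.card_fin]
    exact mul_ballSum_sub_div_le hq2 hn1 hδ0 hδ1 hdn hsn hlam (Nat.cast_nonneg _) hlogs
  · have hV : (Fintype.card (Fin k → F) : ℝ) = (q : ℝ) ^ k := by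
      rw [Fintype.card_fun, Fintype.card_fin]
      push_cast
      rfl
    have hqk : (q : ℝ) ^ k ≤ q * R.card := by
      have : q ^ k ≤ q * R.card := by
        rw [← hR]
        obtain ⟨p, hp⟩ : ∃ p, q = p + 1 := ⟨q - 1, by omega⟩
        rw [hp, Nat.add_sub_cancel]
        nlinarith
      exact_mod_cast this
    rw [Fintype.card_fin, hV]
    exact (sum_relations_le hq2 hqn' hsn hlam (Nat.cast_nonneg _) hqk hρ0.le T).trans hfin
  · rw [Fintype.card_fin]
    refine two_mul_pow_div_factorial_lt hsqrt1 hs5 ?_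
    rw [hT]
    push_cast
    gcongr
    exact Real.real_sqrt_le_nat_sqrt_succ

/-! ### Large fields and the main theorem. -/

theorem succ_le_choose_add {n j : ℕ} (hj : 1 ≤ j) (hjn : j ≤ n) : n + 1 ≤ n.choose j + j := by
  induction n generalizing j with
  | zero => omega
  | succ n ih =>
    obtain ⟨i, rfl⟩ : ∃ i, j = i + 1 := ⟨j - 1, by omega⟩
    rw [Nat.choose_succ_succ]
    rcases Nat.eq_zero_or_pos i with h | h
    · subst h
      simp
    · have h1 := ih h (by omega)
      rcases Nat.lt_or_ge n (i + 1) with h2 | h2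
      · have : n = i := by omega
        subst this
        simp
      · have : 0 < n.choose (i + 1) := Nat.choose_pos h2
        omega

/-- For fields at least as large as the length, the hypothesis is stronger than the Singleton
bound. -/
theorem add_le_of_mul_ballSum_lt {q n e k : ℕ} {δ c M : ℝ} (hq2 : 2 ≤ q) (hnq : n ≤ q)
    (hδ : 0 < δ) (hδ1 : δ < 1) (he : 1 ≤ e) (hen : e ≤ n) (hd : (e : ℝ) ≤ δ * n)
    (hqk : (q : ℝ) ^ k ≤ M) (hc3 : c ≤ (1 - δ) ^ 2)
    (hlt : M * ballSum q n (e + 1) < c * √n * (q : ℝ) ^ n) : k + e < n := by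
  have hq2' : (2 : ℝ) ≤ q := by exact_mod_cast hq2
  have h1δ : 0 < 1 - δ := by linarith
  have hn' : (1 : ℝ) ≤ n := by exact_mod_cast (by omega : 1 ≤ n)
  have hM : 0 ≤ M := (pow_nonneg (by linarith) k).trans hqk
  -- Bernoulli's inequality with `e ≤ δ n ≤ δ q`. This gives one factor `1 - δ` of the bound on `c`;
  -- the other comes from `n.choose e ≥ (1 - δ) n`.
  have hbern : 1 - δ ≤ (1 - 1 / (q : ℝ)) ^ e := by
    have h1 := one_add_mul_le_pow (a := -(1 / (q : ℝ))) (by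
      have : 1 / (q : ℝ) ≤ 1 := by
        rw [div_le_one (by linarith)]
        linarith
      linarith) e
    have h2 : (e : ℝ) * (1 / q) ≤ δ := by
      rw [mul_one_div, div_le_iff₀ (by linarith)]
      have : (n : ℝ) ≤ q := by exact_mod_cast hnq
      nlinarith
    rw [← sub_eq_add_neg] at h1
    linarith
  have hqe : (1 - δ) * (q : ℝ) ^ e ≤ ((q : ℝ) - 1) ^ e := by
    calc (1 - δ) * (q : ℝ) ^ e ≤ (1 - 1 / (q : ℝ)) ^ e * (q : ℝ) ^ e := by gcongr
      _ = _ := by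
        rw [← mul_pow]
        congr 1
        field_simp
  have hch : (1 - δ) * n ≤ n.choose e := by
    have := succ_le_choose_add (n := n) (j := e) (by omega) (by omega)
    have h2 : (n : ℝ) + 1 ≤ n.choose e + e := by exact_mod_cast this
    nlinarith
  have hbs : (n.choose e : ℝ) * ((q : ℝ) - 1) ^ e ≤ ballSum q n (e + 1) :=
    Finset.single_le_sum (f := fun i => (n.choose i : ℝ) * ((q : ℝ) - 1) ^ i)
      (fun i _ => mul_nonneg (Nat.cast_nonneg _) (pow_nonneg (by linarith) _))
      (Finset.mem_range.2 (Nat.lt_succ_self e))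
  have hsqn : √(n : ℝ) ≤ n := by
    rw [Real.sqrt_le_left (by linarith)]
    nlinarith
  have hfinal : (q : ℝ) ^ (k + e) < (q : ℝ) ^ n := by
    have hpos : 0 < (1 - δ) ^ 2 * n := by positivity
    refine lt_of_mul_lt_mul_left ?_ hpos.le
    calc (1 - δ) ^ 2 * n * (q : ℝ) ^ (k + e)
        = (q : ℝ) ^ (k) * (((1 - δ) * n) * ((1 - δ) * (q : ℝ) ^ e)) := by
          rw [pow_add]
          ring
      _ ≤ M * (n.choose e * ((q : ℝ) - 1) ^ e) := by gcongr
      _ ≤ M * ballSum q n (e + 1) := by gcongr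
      _ < c * √n * (q : ℝ) ^ n := hlt
      _ ≤ (1 - δ) ^ 2 * n * (q : ℝ) ^ n := by gcongr
  exact (pow_lt_pow_iff_right₀ (by linarith : (1 : ℝ) < q)).1 hfinal

theorem mainTheorem1 (δ : ℝ) (hδ : 0 < δ) :
    ∃ c : ℝ, 0 < c ∧
      ∀ (F : Type*) [Field F] [Fintype F], δ < 1 - 1 / (Fintype.card F : ℝ) →
        ∀ n k d : ℕ, 1 ≤ n → 1 ≤ k → (d : ℝ) = δ * (n : ℝ) →
          ((Fintype.card F : ℝ) ^ k - 1) / ((Fintype.card F : ℝ) - 1) <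
            c * Real.sqrt (n : ℝ) * (Fintype.card F : ℝ) ^ n /
              (∑ i ∈ Finset.range d, (n.choose i : ℝ) * ((Fintype.card F : ℝ) - 1) ^ i) →
          ∃ C : Submodule F (Fin n → F), IsLinearCode n k d C := by
  rcases le_or_gt 1 δ with h1 | hδ1
  -- No field satisfies `δ < 1 - 1/q` in this case.
  · refine ⟨1, one_pos, fun F _ _ hF => ?_⟩
    have : 0 < 1 / (Fintype.card F : ℝ) := by
      have : 0 < Fintype.card F := Fintype.card_pos
      positivity
    linarith
  obtain ⟨n₀, hn₀⟩ := exists_linearMap_of_card_le_sqrt hδ hδ1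
  obtain ⟨n₁, hn₁⟩ := exists_nat_gt (1 / δ)
  have h1δ : 0 < 1 - δ := by linarith
  -- The three bounds on `c` serve bounded `n`, the case `q ≤ n`, and the case `q ≥ n` in turn; `n₁
  -- > 1/δ` makes `d ≥ 2` for large `n`.
  refine ⟨min (1 / √(n₀ + n₁ + 1 : ℕ)) (min (1 / 4) ((1 - δ) ^ 2)), by positivity,
    fun F _ _ hF n k d hn hk hd hlt => ?_⟩
  classical
  set c := min (1 / √(n₀ + n₁ + 1 : ℕ)) (min (1 / 4) ((1 - δ) ^ 2)) with hc
  have hc1 : c ≤ 1 / √(n₀ + n₁ + 1 : ℕ) := min_le_left _ _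
  have hc2 : c ≤ 1 / 4 := (min_le_right _ _).trans (min_le_left _ _)
  have hc3 : c ≤ (1 - δ) ^ 2 := (min_le_right _ _).trans (min_le_right _ _)
  have hq2 : 2 ≤ Fintype.card F := Fintype.one_lt_card
  change _ < _ / ballSum (Fintype.card F) n d at hlt
  have hn' : (1 : ℝ) ≤ n := by exact_mod_cast hn
  have hd1 : 1 ≤ d := by
    have : (0 : ℝ) < d := by rw [hd]; positivity
    exact_mod_cast this
  have hdn : d < n := by
    have : (d : ℝ) < n := by rw [hd]; nlinarith
    exact_mod_cast this
  obtain ⟨R, hR0, hprop, hrep, hcard⟩ := exists_lines_representatives F (Fin k → F)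
  rw [Nat.card_eq_fintype_card, Fintype.card_fun, Fintype.card_fin] at hcard
  have hq2' : (2 : ℝ) ≤ Fintype.card F := by exact_mod_cast hq2
  have hRcard : ((Fintype.card F : ℝ) ^ k - 1) / ((Fintype.card F : ℝ) - 1) = R.card := by
    rw [div_eq_iff (by linarith)]
    have := congrArg (Nat.cast (R := ℝ)) hcard
    push_cast [Nat.cast_sub (show 1 ≤ Fintype.card F by omega)] at this
    linarith
  rw [hRcard] at hlt
  set q := Fintype.card F with hq
  have hB1 := one_le_ballSum (q := q) (by omega) n hd1
  have hqn : 0 < (q : ℝ) ^ n := by positivity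
  rw [lt_div_iff₀ (by linarith)] at hlt
  have hR1 : 1 ≤ R.card := by
    by_contra! h
    have h0 : R.card = 0 := by omega
    rw [h0, zero_mul, zero_add] at hcard
    have := Nat.one_lt_pow (n := k) (by omega) (show 1 < q by omega)
    omega
  have hsq : 0 ≤ √(n : ℝ) := Real.sqrt_nonneg _
  suffices h : ∃ G : (Fin k → F) →ₗ[F] (Fin n → F), ∀ u, u ≠ 0 → d ≤ hammingNorm (G u) by
    obtain ⟨G, hG⟩ := h
    exact exists_isLinearCode_of_linearMap hk hd1 G hG
  have hreps : (∃ G : (Fin k → F) →ₗ[F] (Fin n → F), ∀ u ∈ R, d ≤ hammingNorm (G u)) →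
      ∃ G : (Fin k → F) →ₗ[F] (Fin n → F), ∀ u, u ≠ 0 → d ≤ hammingNorm (G u) := by
    rintro ⟨G, hG⟩
    refine ⟨G, fun x hx => ?_⟩
    obtain ⟨u, hu, a, ha, rfl⟩ := hrep x hx
    rw [map_smul, hammingNorm_smul fun _ => IsSMulRegular.of_ne_zero ha]
    exact hG u hu
  rcases Nat.lt_or_ge n (n₀ + n₁ + 1) with hsmall | hlarge
  · refine hreps (exists_linearMap_of_card_mul_lt R hR0 d ?_)
    rw [Fintype.card_fin]
    refine hlt.trans_le ?_
    have h2 : √(n : ℝ) ≤ √(n₀ + n₁ + 1 : ℕ) := Real.sqrt_le_sqrt (by exact_mod_cast hsmall.le)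
    have h3 : 0 < √((n₀ + n₁ + 1 : ℕ) : ℝ) := Real.sqrt_pos.2 (by positivity)
    have h4 : c * √(n : ℝ) ≤ 1 := by
      calc c * √(n : ℝ) ≤ 1 / √(n₀ + n₁ + 1 : ℕ) * √(n₀ + n₁ + 1 : ℕ) := by gcongr
        _ = 1 := by field_simp
    nlinarith
  rcases le_total q n with hqn' | hnq
  · refine hreps (hn₀ n (by omega) F hF hqn' k d hd1 hd R hR0 hprop hR1 hcard ?_)
    rw [div_le_iff₀ hqn]
    refine hlt.le.trans ?_
    have : c * √(n : ℝ) ≤ √(n : ℝ) / 4 := by nlinarith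
    gcongr
  · refine exists_reedSolomon hnq ?_
    have hd2 : 2 ≤ d := by
      have h2 : (1 : ℝ) < d := by
        rw [hd]
        have : (n₁ : ℝ) ≤ n := by exact_mod_cast (by omega : n₁ ≤ n)
        rw [div_lt_iff₀ hδ] at hn₁
        nlinarith
      exact_mod_cast h2
    obtain ⟨e, rfl⟩ : ∃ e, d = e + 1 := ⟨d - 1, by omega⟩
    -- The lines number at least `q^(k-1)`. With `e = d - 1` the conclusion `(k - 1) + e < n` is
    -- exactly the Singleton condition `k + d ≤ n + 1`.
    have hqk : (q : ℝ) ^ (k - 1) ≤ R.card := by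
      have h1 : q ^ (k - 1) * (q - 1) < (R.card + 1) * (q - 1) := by
        obtain ⟨p, hp⟩ : ∃ p, q = p + 1 := ⟨q - 1, by omega⟩
        obtain ⟨j, rfl⟩ : ∃ j, k = j + 1 := ⟨k - 1, by omega⟩
        rw [pow_succ] at hcard
        rw [Nat.add_sub_cancel]
        have : 1 ≤ q ^ j := Nat.one_le_pow _ _ (by omega)
        rw [hp, Nat.add_sub_cancel] at hcard ⊢
        rw [hp] at this
        nlinarith
      have h2 := Nat.lt_of_mul_lt_mul_right h1
      exact_mod_cast Nat.lt_succ_iff.1 h2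
    have hdn' : (e : ℝ) ≤ δ * n := by
      push_cast at hd
      linarith
    have := add_le_of_mul_ballSum_lt (k := k - 1) hq2 hnq hδ hδ1 (by omega) (by omega) hdn' hqk hc3
      hlt
    omega
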